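/- **Setting.** Let $A\subset\mathbb{R}^d$ be a $d$-dimensional polytope (the allocation space), and let $\Theta\subset\mathbb{R}^d\setminus\{0\}$ (the type space) be such that $\{\lambda\theta : \theta\in\Theta,\ \lambda\ge 0\}$ is a $d$-dimensional polyhedral cone. There may be a veto allocation $\underline a$; if so, $\underline a$ is an extreme point of $A$ and $\underline a\in\arg\max_{a\in A} a\cdot\theta$ for some $\theta\in\Theta$. A measurable map $x:\Theta\to A$ is an IC and IR mechanism if $x(\theta)\cdot\theta\ge x(\theta')\cdot\theta$ for all $\theta,\theta'\in\Theta$ and, when a veto allocation exists, $x(\theta)\cdot\theta\ge\underline a\cdot\theta$ for all $\theta\in\Theta$. Two mechanisms $x,x'$ are payoff-equivalent if $x(\theta)\cdot\theta=x'(\theta)\cdot\theta$ for all $\theta\in\Theta$. Let $\mathcal X$ be the convex set of payoff-equivalence classes of IC and IR mechanisms, and $\operatorname{ext}\mathcal X$ its set of extreme points. For $x\in\mathcal X$ let $$\operatorname{menu}(x)=\operatorname{cl}\bigcap\{x'(\Theta) : x' \text{ is an IC and IR mechanism payoff-equivalent to } x\}.$$ Let $\mathcal F$ be the finite set of facet-defining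 hyperplanes of $A$, and $\mathcal F(x)=\{H\in\mathcal F : \operatorname{menu}(x)\cap H\neq\emptyset\}$. A mechanism $x\in\mathcal X$ is *exhaustive* if there is no $x'\in\mathcal X$ with $x'\ne x$ and $\mathcal F(x)\subseteq\mathcal F(x')$ that is positively homothetic to $x$, i.e. such that $x=\lambda x'+t$ (up to payoff-equivalence) for some $\lambda>0$ and $t\in\mathbb{R}^d$. **Theorem.** Suppose $d=2$. Then every extreme point $x\in\operatorname{ext}\mathcal X$ is exhaustive, its menu is finite, and $|\operatorname{menu}(x)|\le|\mathcal F|$. -/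

import Mathlib

open scoped RealInnerProductSpace

/-- The Euclidean space `ℝ^d`. -/
abbrev EucSp (d : ℕ) : Type := EuclideanSpace ℝ (Fin d)

/-- The union of all rays through the type space, `{r θ | θ ∈ Θ, r ≥ 0}`. -/
def typeCone {d : ℕ} (Θ : Set (EucSp d)) : Set (EucSp d) :=
  {y | ∃ r : ℝ, 0 ≤ r ∧ ∃ θ ∈ Θ, y = r • θ}

/-- A polytope: the convex hull of finitely many points. -/
def IsPolytope {d : ℕ} (A : Set (EucSp d)) : Prop :=
  ∃ S : Set (EucSp d), S.Finite ∧ A = convexHull ℝ S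

/-- A polyhedral cone: the intersection of finitely many closed halfspaces
bounded by hyperplanes through the origin. -/
def IsPolyhedralCone {d : ℕ} (C : Set (EucSp d)) : Prop :=
  ∃ S : Set (EucSp d), S.Finite ∧ C = {y | ∀ n ∈ S, ⟪n, y⟫ ≤ 0}

/-- A linear screening problem with allocations in `ℝ^d`: a `d`-dimensional allocation polytope,
a type space not containing `0` whose rays form a `d`-dimensional polyhedral cone, and possibly
(`veto = some a`) a veto allocation `a`, which is a vertex of the allocation polytope and a
favorite allocation of at least one type. If `veto = none`, there is no veto allocation. -/
structure ScreeningProblem (d : ℕ) where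
  alloc : Set (EucSp d)
  types : Set (EucSp d)
  veto : Option (EucSp d)
  alloc_polytope : IsPolytope alloc
  alloc_fullDim : (interior alloc).Nonempty
  zero_notMem_types : (0 : EucSp d) ∉ types
  typeCone_polyhedral : IsPolyhedralCone (typeCone types)
  typeCone_fullDim : (interior (typeCone types)).Nonempty
  veto_extreme : ∀ a ∈ veto, a ∈ alloc.extremePoints ℝ
  veto_favorite : ∀ a ∈ veto, ∃ θ ∈ types, ∀ b ∈ alloc, ⟪b, θ⟫ ≤ ⟪a, θ⟫

namespace ScreeningProblem

variable {d : ℕ}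

/-- `x` is a (direct, measurable) incentive-compatible and individually rational mechanism. -/
structure IsICIRMechanism (P : ScreeningProblem d) (x : P.types → EucSp d) : Prop where
  measurable : Measurable x
  feasible : ∀ θ, x θ ∈ P.alloc
  ic : ∀ θ θ' : P.types, ⟪x θ', (θ : EucSp d)⟫ ≤ ⟪x θ, (θ : EucSp d)⟫
  ir : ∀ a ∈ P.veto, ∀ θ : P.types, ⟪a, (θ : EucSp d)⟫ ≤ ⟪x θ, (θ : EucSp d)⟫

/-- The functions on the type space that give every type utility zero. Two mechanisms are
payoff-equivalent, i.e. have the same indirect utility function `θ ↦ x(θ) · θ`, exactly when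
their difference lies in this subspace. -/
def payoffNull (P : ScreeningProblem d) : Submodule ℝ (P.types → EucSp d) where
  carrier := {f | ∀ θ : P.types, ⟪f θ, (θ : EucSp d)⟫ = 0}
  add_mem' := by
    intro f g hf hg θ
    have h1 := hf θ
    have h2 := hg θ
    simp only [Pi.add_apply, inner_add_left, h1, h2, add_zero]
  zero_mem' := by
    intro θ
    simp
  smul_mem' := by
    intro c f hf θ
    have h1 := hf θ
    simp only [Pi.smul_apply, real_inner_smul_left, h1, mul_zero]

/-- The vector space of functions from types to `ℝ^d` up to payoff-equivalence. -/
abbrev PayoffClass (P : ScreeningProblem d) : Type :=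
  (P.types → EucSp d) ⧸ P.payoffNull

/-- The payoff-equivalence class of a function on the type space. -/
def toClass (P : ScreeningProblem d) (x : P.types → EucSp d) : P.PayoffClass :=
  P.payoffNull.mkQ x

/-- Two functions have the same class exactly when they are payoff-equivalent. -/
theorem toClass_eq_iff (P : ScreeningProblem d) (x y : P.types → EucSp d) :
    P.toClass x = P.toClass y ↔
      ∀ θ : P.types, ⟪x θ, (θ : EucSp d)⟫ = ⟪y θ, (θ : EucSp d)⟫ := by
  unfold toClass
  rw [Submodule.mkQ_apply, Submodule.mkQ_apply, Submodule.Quotient.eq]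
  constructor
  · intro h θ
    have h1 := h θ
    rw [Pi.sub_apply, inner_sub_left] at h1
    exact sub_eq_zero.mp h1
  · intro h θ
    rw [Pi.sub_apply, inner_sub_left]
    exact sub_eq_zero.mpr (h θ)

/-- The set `𝒳` of payoff-equivalence classes of IC and IR mechanisms. -/
def mechanisms (P : ScreeningProblem d) : Set P.PayoffClass :=
  {ξ | ∃ x, P.IsICIRMechanism x ∧ P.toClass x = ξ}

/-- The (essential) menu of a class: the closure of the set of allocations that are made by every
IC and IR mechanism in the class. -/
def menu (P : ScreeningProblem d) (ξ : P.PayoffClass) : Set (EucSp d) :=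
  closure (⋂ x ∈ {x | P.IsICIRMechanism x ∧ P.toClass x = ξ}, Set.range x)

/-- The set `ℱ` of facet-defining hyperplanes of the allocation polytope: the supporting
hyperplanes that intersect the polytope in a face of dimension `d - 1`. -/
def facetHyperplanes (P : ScreeningProblem d) : Set (Set (EucSp d)) :=
  {H | ∃ (n : EucSp d) (c : ℝ), ‖n‖ = 1 ∧ H = {y | ⟪n, y⟫ = c} ∧
    (∀ a ∈ P.alloc, ⟪n, a⟫ ≤ c) ∧ (P.alloc ∩ H).Nonempty ∧
    Module.finrank ℝ (vectorSpan ℝ (P.alloc ∩ H)) + 1 = d}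

/-- The binding feasibility constraints of a mechanism: the facet-defining hyperplanes
that meet its menu. -/
def bindingFacets (P : ScreeningProblem d) (ξ : P.PayoffClass) : Set (Set (EucSp d)) :=
  {H ∈ P.facetHyperplanes | (P.menu ξ ∩ H).Nonempty}

/-- `ξ` arises from `ξ'` by scaling with a positive scalar and translation. -/
def PosHomothetic (P : ScreeningProblem d) (ξ ξ' : P.PayoffClass) : Prop :=
  ∃ (r : ℝ) (t : EucSp d), 0 < r ∧ ξ = r • ξ' + P.toClass (fun _ => t)

/-- A mechanism is exhaustive if no other mechanism that is positively homothetic to it makes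
an inclusion-wise larger (or equal) set of feasibility constraints binding. -/
def Exhaustive (P : ScreeningProblem d) (ξ : P.PayoffClass) : Prop :=
  ¬ ∃ ξ' ∈ P.mechanisms, ξ' ≠ ξ ∧ P.PosHomothetic ξ ξ' ∧
    P.bindingFacets ξ ⊆ P.bindingFacets ξ'

end ScreeningProblem

/-!
A mechanism is determined up to payoff-equivalence by its indirect utility `U`. Its *sharp points*
are the points of the plane that some type must receive given `U`, that is, the gradients of `U`.
They lie in the range of every mechanism of the class, and if there are finitely many of them,
Rademacher's theorem shows that every type obtains its utility from one of them, so that the menu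
is the set of sharp points (`IsICIRMechanism.menu_eq`).

An extreme mechanism cannot be perturbed in two opposite directions that keep feasibility and
incentive compatibility (`inner_eq_zero_of_mem_extremePoints`). Participation imposes no
restriction here: it only matters for types whose favorite allocation is the veto allocation
(`ir_of_favorite`), and their utility is already maximal.

*Counting.* Let `E` be the closure of the range of a mechanism and suppose that there are more
sharp points than facets, say `k + 1` of them with `k` facets. Traverse the boundary of the convex
hull of `E` by its outer normals and displace it by a translation, a homothety, and, for each of
`k` marked sharp points, a homothety applied only to the part between this point and the remaining
marked point. These are `k + 3` parameters. Two linear conditions make the displacement close up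
after one turn (`Markers.defect`), and one condition per facet keeps the support number in the
direction of the facet's normal fixed. So a nonzero displacement remains. Its local homotheties
preserve monotonicity of the boundary when scaled down (`Markers.inner_add_smul_field_le`), that
is, incentive compatibility, and then the fixed support numbers give feasibility, since the
polygon is the intersection of its facet halfspaces (`mem_alloc_of_facets`). By extremality, it
leaves the utilities and hence all marked points in place, which forces it to vanish
(`Markers.eq_zero_of_field_eq_zero`).

*Exhaustiveness.* If a homothetic mechanism `ξ'` binds the facets that `ξ` binds, then the
homothety fixes the hyperplanes of these facets, and the finite menu has slack at all others. So
one can move slightly from `ξ` both towards and away from `ξ'`, and extremality gives `ξ' = ξ`.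
-/

/-! ### The Euclidean plane -/

theorem inner_two (x y : EucSp 2) : ⟪x, y⟫ = x 0 * y 0 + x 1 * y 1 := by
  simp [PiLp.inner_apply, Fin.sum_univ_two, mul_comm]

theorem exists_smul_of_orthogonal {n v w : EucSp 2} (hn : n ≠ 0) (hv : ⟪n, v⟫ = 0)
    (hw : ⟪n, w⟫ = 0) (hw0 : w ≠ 0) : ∃ u : ℝ, v = u • w := by
  rw [inner_two] at hv hw
  have hn' : n 0 ≠ 0 ∨ n 1 ≠ 0 := by
    by_contra! h
    apply hn
    ext i
    fin_cases i
    · exact h.1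
    · exact h.2
  have hcross : v 0 * w 1 - v 1 * w 0 = 0 := by
    rcases hn' with h | h
    · apply mul_left_cancel₀ h
      linear_combination w 1 * hv - v 1 * hw
    · apply mul_left_cancel₀ h
      linear_combination v 0 * hw - w 0 * hv
  have hww : w 0 * w 0 + w 1 * w 1 ≠ 0 := by
    rw [← inner_two]
    exact inner_self_ne_zero.mpr hw0
  refine ⟨(v 0 * w 0 + v 1 * w 1) / (w 0 * w 0 + w 1 * w 1), ?_⟩
  ext i
  fin_cases i
  · simp only [PiLp.smul_apply, smul_eq_mul, Fin.zero_eta]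
    rw [div_mul_eq_mul_div, eq_div_iff hww]
    linear_combination w 1 * hcross
  · simp only [PiLp.smul_apply, smul_eq_mul, Fin.mk_one]
    rw [div_mul_eq_mul_div, eq_div_iff hww]
    linear_combination -w 0 * hcross

/-- The rotation of a vector of the plane by a right angle. -/
def rotate (e : EucSp 2) : EucSp 2 := !₂[-e 1, e 0]

@[simp] theorem rotate_zero_apply (e : EucSp 2) : rotate e 0 = -e 1 := rfl
@[simp] theorem rotate_one_apply (e : EucSp 2) : rotate e 1 = e 0 := rfl

theorem rotate_ne_zero {e : EucSp 2} (he : e ≠ 0) : rotate e ≠ 0 := by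
  intro h
  apply he
  have h0 := congrArg (fun v : EucSp 2 => v 0) h
  have h1 := congrArg (fun v : EucSp 2 => v 1) h
  simp at h0 h1
  ext i
  fin_cases i
  · simpa using h1
  · simpa using h0

theorem inner_rotate_self (e : EucSp 2) : ⟪rotate e, e⟫ = 0 := by
  rw [inner_two]; simp; ring

/-- A set on a line that contains two points is one-dimensional. -/
theorem finrank_vectorSpan_eq_one {F : Set (EucSp 2)} {n a b : EucSp 2} {c : ℝ} (hn : n ≠ 0)
    (hF : ∀ z ∈ F, ⟪n, z⟫ = c) (ha : a ∈ F) (hb : b ∈ F) (hab : a ≠ b) :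
    Module.finrank ℝ (vectorSpan ℝ F) = 1 := by
  have hle : ∀ w ∈ vectorSpan ℝ F, ⟪n, w⟫ = 0 := by
    intro w hw
    rw [vectorSpan_def] at hw
    induction hw using Submodule.span_induction with
    | mem w hw =>
      obtain ⟨p, hp, q, hq, rfl⟩ := hw
      simp [inner_sub_right, hF p hp, hF q hq]
    | zero => simp
    | add v w _ _ hv hw => rw [inner_add_right, hv, hw, add_zero]
    | smul r v _ hv => rw [inner_smul_right, hv, mul_zero]
  have hmem : a - b ∈ vectorSpan ℝ F := vsub_mem_vectorSpan ℝ ha hb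
  refine finrank_eq_one (⟨a - b, hmem⟩ : vectorSpan ℝ F) ?_ ?_
  · intro h
    exact hab (sub_eq_zero.mp (congrArg Subtype.val h))
  · rintro ⟨w, hw⟩
    obtain ⟨u, hu⟩ := exists_smul_of_orthogonal hn (hle w hw) (hle _ hmem) (sub_ne_zero.mpr hab)
    exact ⟨u, Subtype.ext hu.symm⟩

/-! ### Facets of the allocation polygon -/

namespace ScreeningProblem

theorem isCompact_alloc {d : ℕ} (P : ScreeningProblem d) : IsCompact P.alloc := by
  obtain ⟨S, hS, h⟩ := P.alloc_polytope
  rw [h]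
  exact hS.isCompact_convexHull ℝ

theorem convex_alloc {d : ℕ} (P : ScreeningProblem d) : Convex ℝ P.alloc := by
  obtain ⟨S, hS, h⟩ := P.alloc_polytope
  rw [h]
  exact convex_convexHull ℝ S

end ScreeningProblem

/-- A linear inequality strict at the base point persists along a short perturbation. -/
theorem eventually_inner_add_smul_lt {m v z : EucSp 2} {c : ℝ} (h : ⟪m, z⟫ < c) :
    ∀ᶠ ε : ℝ in nhds 0, ⟪m + ε • v, z⟫ < c := by
  have hc : Continuous fun ε : ℝ => ⟪m + ε • v, z⟫ := by fun_prop
  exact hc.continuousAt.eventually_lt continuousAt_const (by simpa using h)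

/-- An extreme point of a planar set cut out by finitely many inequalities `⟪m, z⟫ ≤ 1` makes two
of them binding. -/
theorem exists_two_active_of_mem_extremePoints {T : Set (EucSp 2)} (hT : T.Finite) {m : EucSp 2}
    (hm : m ∈ {m : EucSp 2 | ∀ z ∈ T, ⟪m, z⟫ ≤ 1}.extremePoints ℝ) :
    ∃ z ∈ T, ∃ z' ∈ T, z ≠ z' ∧ ⟪m, z⟫ = 1 ∧ ⟪m, z'⟫ = 1 := by
  by_contra! h
  obtain ⟨v, hv0, hv⟩ : ∃ v : EucSp 2, v ≠ 0 ∧ ∀ z ∈ T, ⟪m, z⟫ = 1 → ⟪v, z⟫ = 0 := by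
    by_cases hz : ∃ z ∈ T, ⟪m, z⟫ = 1
    · obtain ⟨z, hzT, hz⟩ := hz
      refine ⟨rotate z, rotate_ne_zero ?_, fun z' hz'T hz' => ?_⟩
      · rintro rfl
        simp at hz
      · have : z = z' := by
          by_contra hne
          exact h z hzT z' hz'T hne hz hz'
        rw [← this, inner_rotate_self]
    · push Not at hz
      refine ⟨!₂[1, 0], ?_, fun z hzT h1 => absurd h1 (hz z hzT)⟩
      intro h0
      have := congrArg (fun v : EucSp 2 => v 0) h0
      simp at this
  have hev : ∀ᶠ ε : ℝ in nhds 0, ∀ z ∈ T, ⟪m + ε • v, z⟫ ≤ 1 := by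
    rw [Filter.eventually_all_finite hT]
    intro z hz
    rcases (hm.1 z hz).lt_or_eq with hlt | heq
    · filter_upwards [eventually_inner_add_smul_lt (v := v) hlt] with ε hε using hε.le
    · refine Filter.Eventually.of_forall fun ε => ?_
      rw [inner_add_left, real_inner_smul_left, hv z hz heq, heq]
      simp
  have hneg : ∀ᶠ ε : ℝ in nhds 0, ∀ z ∈ T, ⟪m + (-ε) • v, z⟫ ≤ 1 := by
    have : Filter.Tendsto (fun ε : ℝ => -ε) (nhds 0) (nhds 0) := by
      simpa using (continuous_neg (G := ℝ)).tendsto 0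
    exact this.eventually hev
  obtain ⟨ε, ⟨h1, h2⟩, hε⟩ := (((hev.and hneg).filter_mono nhdsWithin_le_nhds).and
    (self_mem_nhdsWithin (s := Set.Ioi (0 : ℝ)))).exists
  have hε0 : (0 : ℝ) < ε := hε
  have hmid : m ∈ openSegment ℝ (m + ε • v) (m + (-ε) • v) := by
    refine ⟨1 / 2, 1 / 2, by norm_num, by norm_num, by norm_num, ?_⟩
    module
  have := hm.2 h1 h2 hmid
  rw [add_eq_left, smul_eq_zero] at this
  exact this.elim hε0.ne' hv0

namespace ScreeningProblem

/-- A point outside the allocation polygon violates a facet inequality. The normal of the violated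
facet is a vertex of the polar of the polygon (taken about an interior point `p`): at a vertex two
of the finitely many defining inequalities of the polar bind, so the face exposed by the normal
contains two points. -/
theorem exists_facet_separating (P : ScreeningProblem 2) {p y : EucSp 2}
    (hp : p ∈ interior P.alloc) (hy : y ∉ P.alloc) :
    ∃ (n : EucSp 2) (c : ℝ), {z | ⟪n, z⟫ = c} ∈ P.facetHyperplanes ∧
      (∀ a ∈ P.alloc, ⟪n, a⟫ ≤ c) ∧ ⟪n, p⟫ < c ∧ c < ⟪n, y⟫ := by
  obtain ⟨S, hS, hA⟩ := P.alloc_polytope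
  set T : Set (EucSp 2) := (fun a => a - p) '' S with hTdef
  have hT : T.Finite := hS.image _
  set Q : Set (EucSp 2) := {m : EucSp 2 | ∀ z ∈ T, ⟪m, z⟫ ≤ 1} with hQ
  have hQA : ∀ m ∈ Q, ∀ a ∈ P.alloc, ⟪m, a - p⟫ ≤ 1 := by
    intro m hm a ha
    rw [hA] at ha
    have hconv : Convex ℝ {a : EucSp 2 | ⟪m, a⟫ ≤ 1 + ⟪m, p⟫} :=
      convex_halfSpace_le (innerₛₗ ℝ m).isLinear _
    have hsub : S ⊆ {a : EucSp 2 | ⟪m, a⟫ ≤ 1 + ⟪m, p⟫} := by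
      intro s hs
      have := hm (s - p) ⟨s, hs, rfl⟩
      rw [inner_sub_right] at this
      simp only [Set.mem_ofPred_eq]
      linarith
    have := convexHull_min hsub hconv ha
    simp only [Set.mem_ofPred_eq] at this
    rw [inner_sub_right]
    linarith
  have hQclosed : IsClosed Q := by
    have : Q = ⋂ z ∈ T, {m : EucSp 2 | ⟪m, z⟫ ≤ 1} := by
      ext m; simp [hQ]
    rw [this]
    exact isClosed_biInter fun z _ => isClosed_le (by fun_prop) continuous_const
  obtain ⟨δ, hδ, hball⟩ := Metric.isOpen_iff.mp isOpen_interior p hp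
  have hQbdd : Q ⊆ Metric.closedBall 0 (2 / δ) := by
    intro m hm
    rw [mem_closedBall_zero_iff]
    by_cases h0 : m = 0
    · rw [h0, norm_zero]; positivity
    have hpos : 0 < ‖m‖ := norm_pos_iff.mpr h0
    have hmem : p + (δ / 2 / ‖m‖) • m ∈ P.alloc := by
      apply interior_subset (hball _)
      rw [mem_ball_iff_norm, add_sub_cancel_left, norm_smul, Real.norm_of_nonneg (by positivity)]
      field_simp
      linarith
    have := hQA m hm _ hmem
    rw [add_sub_cancel_left, inner_smul_right, real_inner_self_eq_norm_sq] at this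
    have h2 : δ / 2 / ‖m‖ * ‖m‖ ^ 2 = δ / 2 * ‖m‖ := by field_simp
    rw [h2] at this
    rw [le_div_iff₀ hδ]
    linarith
  have hQcomp : IsCompact Q :=
    (isCompact_closedBall _ _).of_isClosed_subset hQclosed hQbdd
  -- a separating functional, normalized to lie in the polar
  obtain ⟨m₀, hm₀, hm₀y⟩ : ∃ m₀ ∈ Q, 1 < ⟪m₀, y - p⟫ := by
    obtain ⟨f, u, hf, hfy⟩ := geometric_hahn_banach_closed_point P.convex_alloc
      P.isCompact_alloc.isClosed hy
    obtain ⟨q, rfl⟩ := (InnerProductSpace.toDual ℝ (EucSp 2)).surjective f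
    simp only [InnerProductSpace.toDual_apply_apply] at hf hfy
    have hup : 0 < u - ⟪q, p⟫ := sub_pos.mpr (hf p (interior_subset hp))
    refine ⟨(u - ⟪q, p⟫)⁻¹ • q, ?_, ?_⟩
    · rintro z ⟨a, ha, rfl⟩
      have haA : a ∈ P.alloc := hA ▸ subset_convexHull ℝ S ha
      have := hf a haA
      rw [real_inner_smul_left, inner_sub_right, inv_mul_le_iff₀ hup]
      linarith
    · rw [real_inner_smul_left, inner_sub_right, lt_inv_mul_iff₀ hup]
      linarith
  obtain ⟨m, hmext, hmy⟩ : ∃ m ∈ Q.extremePoints ℝ, 1 < ⟪m, y - p⟫ := by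
    set l : StrongDual ℝ (EucSp 2) := innerSL ℝ (y - p) with hl
    set B : Set (EucSp 2) := {m ∈ Q | ∀ m' ∈ Q, l m' ≤ l m} with hB
    have hexp : IsExposed ℝ Q B := fun _ => ⟨l, rfl⟩
    obtain ⟨m₁, hm₁, hmax⟩ := hQcomp.exists_isMaxOn ⟨m₀, hm₀⟩ l.continuous.continuousOn
    have hBne : B.Nonempty := ⟨m₁, hm₁, fun m' hm' => hmax hm'⟩
    obtain ⟨m, hm⟩ := (hexp.isCompact hQcomp).extremePoints_nonempty hBne
    refine ⟨m, hexp.isExtreme.extremePoints_subset_extremePoints hm, ?_⟩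
    have h1 := hm.1.2 m₀ hm₀
    simp only [hl, innerSL_apply_apply] at h1
    rw [real_inner_comm] at hm₀y ⊢
    linarith
  obtain ⟨_, ⟨a, ha, rfl⟩, _, ⟨b, hb, rfl⟩, hab, hma, hmb⟩ :=
    exists_two_active_of_mem_extremePoints hT hmext
  have hmQ : m ∈ Q := hmext.1
  have hm0 : m ≠ 0 := by
    rintro rfl
    simp at hma
  have hpos : 0 < ‖m‖ := norm_pos_iff.mpr hm0
  have haA : a ∈ P.alloc := hA ▸ subset_convexHull ℝ S ha
  have hbA : b ∈ P.alloc := hA ▸ subset_convexHull ℝ S hb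
  have hone : ‖(‖m‖⁻¹ • m)‖ = 1 := by
    rw [norm_smul, norm_inv, norm_norm, inv_mul_cancel₀ hpos.ne']
  have hle : ∀ a ∈ P.alloc, ⟪‖m‖⁻¹ • m, a⟫ ≤ ‖m‖⁻¹ * (1 + ⟪m, p⟫) := by
    intro a ha
    have := hQA m hmQ a ha
    rw [inner_sub_right] at this
    rw [real_inner_smul_left]
    gcongr
    linarith
  rw [inner_sub_right] at hma hmb hmy
  have haH : ⟪‖m‖⁻¹ • m, a⟫ = ‖m‖⁻¹ * (1 + ⟪m, p⟫) := by
    rw [real_inner_smul_left, ← hma]; ring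
  have hbH : ⟪‖m‖⁻¹ • m, b⟫ = ‖m‖⁻¹ * (1 + ⟪m, p⟫) := by
    rw [real_inner_smul_left, ← hmb]; ring
  refine ⟨‖m‖⁻¹ • m, ‖m‖⁻¹ * (1 + ⟪m, p⟫), ⟨_, _, hone, rfl, hle, ⟨a, haA, haH⟩, ?_⟩, hle, ?_, ?_⟩
  · rw [finrank_vectorSpan_eq_one
      (F := P.alloc ∩ {y | ⟪‖m‖⁻¹ • m, y⟫ = ‖m‖⁻¹ * (1 + ⟪m, p⟫)})
      (by rw [← norm_ne_zero_iff, hone]; exact one_ne_zero) (fun z hz => hz.2) ⟨haA, haH⟩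
      ⟨hbA, hbH⟩ (fun h => hab (by rw [h]))]
  · rw [real_inner_smul_left]
    gcongr
    linarith
  · rw [real_inner_smul_left]
    gcongr
    linarith

/-- The allocation polygon is the intersection of its facet halfspaces. Any supporting halfspace
bounded by the facet may be used for each facet. -/
theorem mem_alloc_of_facets (P : ScreeningProblem 2) {y : EucSp 2}
    (h : ∀ H ∈ P.facetHyperplanes, ∃ (n : EucSp 2) (c : ℝ), H = {z | ⟪n, z⟫ = c} ∧
      (∀ a ∈ P.alloc, ⟪n, a⟫ ≤ c) ∧ ⟪n, y⟫ ≤ c) : y ∈ P.alloc := by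
  by_contra hy
  obtain ⟨p, hp⟩ := P.alloc_fullDim
  obtain ⟨n, c, hH, hle, hpc, hcy⟩ := P.exists_facet_separating hp hy
  obtain ⟨n', c', hHeq, hle', hy'⟩ := h _ hH
  -- the segment from `p` to `y` crosses the facet hyperplane at an interior point `z`
  set s : ℝ := (c - ⟪n, p⟫) / (⟪n, y⟫ - ⟪n, p⟫) with hs
  have hden : 0 < ⟪n, y⟫ - ⟪n, p⟫ := by linarith
  have hs0 : 0 < s := div_pos (by linarith) hden
  have hs1 : s < 1 := by rw [hs, div_lt_one hden]; linarith
  have hz : p + s • (y - p) ∈ {z | ⟪n, z⟫ = c} := by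
    simp only [Set.mem_ofPred_eq, inner_add_right, inner_smul_right, inner_sub_right, hs]
    field_simp
    ring
  rw [hHeq] at hz
  simp only [Set.mem_ofPred_eq, inner_add_right, inner_smul_right, inner_sub_right] at hz
  have hp' := hle' p (interior_subset hp)
  have hpH : p ∈ {z | ⟪n', z⟫ = c'} := by
    simp only [Set.mem_ofPred_eq]
    nlinarith
  rw [← hHeq] at hpH
  exact hpc.ne hpH

theorem facetHyperplanes_nonempty (P : ScreeningProblem 2) : P.facetHyperplanes.Nonempty := by
  obtain ⟨p, hp⟩ := P.alloc_fullDim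
  obtain ⟨y, hy⟩ : ∃ y, y ∉ P.alloc := by
    by_contra! h
    exact NormedSpace.noncompactSpace ℝ (EucSp 2) |>.noncompact_univ
      (Set.eq_univ_of_forall h ▸ P.isCompact_alloc)
  obtain ⟨n, c, hH, -⟩ := P.exists_facet_separating hp hy
  exact ⟨_, hH⟩

/-- A facet is the convex hull of its vertices, so it contains two of the finitely many points
that span the polygon, and these determine its line. -/
theorem facetHyperplanes_finite (P : ScreeningProblem 2) : P.facetHyperplanes.Finite := by
  obtain ⟨S, hS, hA⟩ := P.alloc_polytope
  refine ((hS.prod hS).image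
    (fun q : EucSp 2 × EucSp 2 => {z | ∃ u : ℝ, z = q.1 + u • (q.2 - q.1)})).subset ?_
  rintro H ⟨n, c, hn, rfl, hle, hne, hrank⟩
  set H : Set (EucSp 2) := {y | ⟪n, y⟫ = c} with hH
  have hn0 : n ≠ 0 := by
    rintro rfl
    simp at hn
  have hexp : IsExposed ℝ P.alloc (P.alloc ∩ H) := by
    intro _
    refine ⟨innerSL ℝ n, ?_⟩
    obtain ⟨a₀, ha₀, ha₀H⟩ := hne
    ext a
    simp only [Set.mem_inter_iff, hH, Set.mem_ofPred_eq, innerSL_apply_apply]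
    refine and_congr_right fun ha => ⟨fun h b hb => h ▸ hle b hb, fun h => ?_⟩
    exact le_antisymm (hle a ha) (ha₀H ▸ h a₀ ha₀)
  have hcomp := hexp.isCompact P.isCompact_alloc
  have hext : (P.alloc ∩ H).extremePoints ℝ ⊆ S ∩ H := by
    intro a ha
    refine ⟨?_, ha.1.2⟩
    have := hexp.isExtreme.extremePoints_subset_extremePoints ha
    rw [hA] at this
    exact extremePoints_convexHull_subset this
  have hnt : (S ∩ H).Nontrivial := by
    by_contra hsub
    rw [Set.not_nontrivial_iff] at hsub
    have hKM := closure_convexHull_extremePoints hcomp (hexp.convex P.convex_alloc)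
    have hsub' : (P.alloc ∩ H).Subsingleton := by
      rw [← hKM]
      rcases (hsub.anti hext).eq_empty_or_singleton with h | ⟨a, h⟩ <;> simp [h]
    rw [vectorSpan_of_subsingleton ℝ hsub'] at hrank
    simp at hrank
  obtain ⟨a, ⟨haS, haH⟩, b, ⟨hbS, hbH⟩, hab⟩ := hnt
  refine ⟨(a, b), ⟨haS, hbS⟩, ?_⟩
  simp only [hH, Set.mem_ofPred_eq] at haH hbH
  ext z
  simp only [Set.mem_ofPred_eq, hH]
  constructor
  · rintro ⟨u, rfl⟩
    rw [inner_add_right, inner_smul_right, inner_sub_right, haH, hbH]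
    ring
  · intro hz
    obtain ⟨u, hu⟩ := exists_smul_of_orthogonal (v := z - a) (w := b - a) hn0
      (by rw [inner_sub_right, hz, haH, sub_self]) (by rw [inner_sub_right, hbH, haH, sub_self])
      (sub_ne_zero.mpr hab.symm)
    exact ⟨u, by rw [← hu]; abel⟩

/-! ### Participation -/

/-- For feasible and incentive-compatible `x`, participation of all types follows from
participation of the types whose favorite allocation is the veto allocation `a`. Otherwise some
type `θ` strictly prefers `a` to `x θ`; moving a favorable type `θ₀` slightly towards `θ` leaves `a`
a favorite, but by subadditivity of the indirect utility it destroys participation. -/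
theorem ir_of_favorite (P : ScreeningProblem 2) {a : EucSp 2} (ha : a ∈ P.veto)
    {x : P.types → EucSp 2} (hfeas : ∀ θ, x θ ∈ P.alloc)
    (hic : ∀ θ θ' : P.types, ⟪x θ', (θ : EucSp 2)⟫ ≤ ⟪x θ, (θ : EucSp 2)⟫)
    (hfav : ∀ θ : P.types, (∀ b ∈ P.alloc, ⟪b, (θ : EucSp 2)⟫ ≤ ⟪a, (θ : EucSp 2)⟫) →
      ⟪a, (θ : EucSp 2)⟫ ≤ ⟪x θ, (θ : EucSp 2)⟫) (θ : P.types) :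
    ⟪a, (θ : EucSp 2)⟫ ≤ ⟪x θ, (θ : EucSp 2)⟫ := by
  by_contra! hlt
  obtain ⟨S, hS, hA⟩ := P.alloc_polytope
  have haext := P.veto_extreme a ha
  obtain ⟨θ₀, hθ₀, hmax⟩ := P.veto_favorite a ha
  have hθ₀0 : θ₀ ≠ 0 := fun h => P.zero_notMem_types (h ▸ hθ₀)
  set b := x ⟨θ₀, hθ₀⟩ with hb
  have hbA : b ∈ P.alloc := hfeas _
  have hbθ₀ : ⟪b, θ₀⟫ = ⟪a, θ₀⟫ := le_antisymm (hmax b hbA) (hfav ⟨θ₀, hθ₀⟩ hmax)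
  have hbθ : ⟪b, (θ : EucSp 2)⟫ < ⟪a, (θ : EucSp 2)⟫ := (hic θ _).trans_lt hlt
  have hba : b - a ≠ 0 := by
    intro h
    rw [sub_eq_zero.mp h] at hbθ
    exact lt_irrefl _ hbθ
  have hev : ∀ᶠ s : ℝ in nhdsWithin 0 (Set.Ioi 0), ∀ p ∈ S,
      ⟪p, θ₀ + s • (θ : EucSp 2)⟫ ≤ ⟪a, θ₀ + s • (θ : EucSp 2)⟫ := by
    rw [Filter.eventually_all_finite hS]
    intro p hp
    have hpA : p ∈ P.alloc := hA ▸ subset_convexHull ℝ S hp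
    rcases (hmax p hpA).lt_or_eq with h | h
    · have hc1 : Continuous fun s : ℝ => ⟪p, θ₀ + s • (θ : EucSp 2)⟫ := by fun_prop
      have hc2 : Continuous fun s : ℝ => ⟪a, θ₀ + s • (θ : EucSp 2)⟫ := by fun_prop
      have : ∀ᶠ s : ℝ in nhds 0, ⟪p, θ₀ + s • (θ : EucSp 2)⟫ < ⟪a, θ₀ + s • (θ : EucSp 2)⟫ :=
        hc1.continuousAt.eventually_lt hc2.continuousAt (by simpa using h)
      exact (this.filter_mono nhdsWithin_le_nhds).mono fun s hs => hs.le
    · obtain ⟨u, hu⟩ := exists_smul_of_orthogonal (v := p - a) (w := b - a) hθ₀0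
        (by rw [inner_sub_right, real_inner_comm, h, real_inner_comm, sub_self])
        (by rw [inner_sub_right, real_inner_comm, hbθ₀, real_inner_comm, sub_self]) hba
      -- `a` is a vertex, so `p` and `b` lie on the same side of `a` on the edge
      have hu0 : 0 ≤ u := by
        by_contra! hneg
        have hseg : a ∈ openSegment ℝ b p := by
          refine ⟨-u / (1 - u), 1 / (1 - u), by apply div_pos <;> linarith,
            by apply div_pos <;> linarith, ?_, ?_⟩
          · rw [← add_div]
            exact (div_eq_one_iff_eq (by linarith)).mpr (by ring)
          · have hp' : p = a + u • (b - a) := by rw [← hu]; abel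
            have h1u : (1 - u) ≠ 0 := by linarith
            rw [hp']
            have : a = (1 - u)⁻¹ • ((1 - u) • a) := by rw [smul_smul, inv_mul_cancel₀ h1u, one_smul]
            conv_rhs => rw [this]
            rw [div_eq_inv_mul, div_eq_inv_mul, mul_smul, mul_smul, ← smul_add]
            congr 1
            module
        have := haext.2 hbA hpA hseg
        exact hba (sub_eq_zero.mpr this)
      filter_upwards [self_mem_nhdsWithin] with s hs
      have hs0 : (0 : ℝ) < s := hs
      have hpθ : ⟪p, (θ : EucSp 2)⟫ ≤ ⟪a, (θ : EucSp 2)⟫ := by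
        have h1 : ⟪p - a, (θ : EucSp 2)⟫ = u * ⟪b - a, (θ : EucSp 2)⟫ := by
          rw [hu, real_inner_smul_left]
        rw [inner_sub_left, inner_sub_left] at h1
        nlinarith
      rw [inner_add_right, inner_add_right, inner_smul_right, inner_smul_right, h]
      nlinarith
  obtain ⟨s, hsS, hs⟩ := (hev.and self_mem_nhdsWithin).exists
  have hs0 : (0 : ℝ) < s := hs
  have hsA : ∀ p ∈ P.alloc, ⟪p, θ₀ + s • (θ : EucSp 2)⟫ ≤ ⟪a, θ₀ + s • (θ : EucSp 2)⟫ := by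
    intro p hp
    rw [hA] at hp
    exact convexHull_min (t := {p | ⟪p, θ₀ + s • (θ : EucSp 2)⟫ ≤ ⟪a, θ₀ + s • (θ : EucSp 2)⟫}) hsS
      (by
        simp_rw [real_inner_comm (θ₀ + s • (θ : EucSp 2))]
        exact convex_halfSpace_le (innerₛₗ ℝ (θ₀ + s • (θ : EucSp 2))).isLinear _) hp
  have hcone : θ₀ + s • (θ : EucSp 2) ∈ typeCone P.types := by
    obtain ⟨N, -, hN⟩ := P.typeCone_polyhedral
    have h1 : θ₀ ∈ typeCone P.types := ⟨1, zero_le_one, θ₀, hθ₀, (one_smul _ _).symm⟩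
    have h2 : (θ : EucSp 2) ∈ typeCone P.types := ⟨1, zero_le_one, θ, θ.2, (one_smul _ _).symm⟩
    rw [hN] at h1 h2 ⊢
    intro n hn
    rw [inner_add_right, inner_smul_right]
    have := h1 n hn
    have := h2 n hn
    nlinarith
  obtain ⟨r, hr, θ₁, hθ₁, heq⟩ := hcone
  have hr0 : 0 < r := by
    refine lt_of_le_of_ne hr ?_
    rintro rfl
    rw [zero_smul] at heq
    have h1 : ⟪b, θ₀ + s • (θ : EucSp 2)⟫ < ⟪a, θ₀ + s • (θ : EucSp 2)⟫ := by
      rw [inner_add_right, inner_add_right, inner_smul_right, inner_smul_right, hbθ₀]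
      nlinarith
    rw [heq] at h1
    simp at h1
  have h1 := hfav ⟨θ₁, hθ₁⟩ (by
    intro p hp
    have := hsA p hp
    rw [heq, inner_smul_right, inner_smul_right] at this
    exact le_of_mul_le_mul_left this hr0)
  set y := x ⟨θ₁, hθ₁⟩
  have h2 : ⟪a, θ₀ + s • (θ : EucSp 2)⟫ ≤ ⟪y, θ₀ + s • (θ : EucSp 2)⟫ := by
    rw [heq, inner_smul_right, inner_smul_right]
    exact mul_le_mul_of_nonneg_left h1 hr
  rw [inner_add_right, inner_add_right, inner_smul_right, inner_smul_right] at h2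
  have h3 : ⟪y, θ₀⟫ ≤ ⟪b, θ₀⟫ := hic ⟨θ₀, hθ₀⟩ ⟨θ₁, hθ₁⟩
  have h4 := hic θ ⟨θ₁, hθ₁⟩
  nlinarith

end ScreeningProblem

/-! ### Sharp points and the menu -/

namespace ScreeningProblem

variable {d : ℕ}

/-- The indirect utility function `θ ↦ x(θ) · θ`. -/
noncomputable def payoff (P : ScreeningProblem d) (x : P.types → EucSp d) (θ : P.types) : ℝ :=
  ⟪x θ, (θ : EucSp d)⟫

/-- The allocations that some type is bound to receive: `a` is sharp for the utility function `U` if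
some type `θ` obtains `U θ` from `a` and from no other point of `ℝ^d` compatible with `U`. These are
the gradients of `U`; feasibility plays no role, so the notion is equivariant under homotheties. -/
def sharpPoints (P : ScreeningProblem d) (U : P.types → ℝ) : Set (EucSp d) :=
  {a | ∃ θ : P.types, ⟪a, (θ : EucSp d)⟫ = U θ ∧ (∀ θ' : P.types, ⟪a, (θ' : EucSp d)⟫ ≤ U θ') ∧
    ∀ b : EucSp d, (∀ θ' : P.types, ⟪b, (θ' : EucSp d)⟫ ≤ U θ') →
      ⟪b, (θ : EucSp d)⟫ = U θ → b = a}

theorem toClass_eq_iff_payoff (P : ScreeningProblem d) (x y : P.types → EucSp d) :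
    P.toClass x = P.toClass y ↔ P.payoff x = P.payoff y := by
  rw [toClass_eq_iff, funext_iff]
  rfl

theorem IsICIRMechanism.mem_range_of_sharp {P : ScreeningProblem d} {x : P.types → EucSp d}
    (hx : P.IsICIRMechanism x) {a : EucSp d} (ha : a ∈ P.sharpPoints (P.payoff x)) :
    a ∈ Set.range x := by
  obtain ⟨θ, -, -, h⟩ := ha
  exact ⟨θ, h (x θ) (fun θ' => hx.ic θ' θ) rfl⟩

theorem types_nonempty (P : ScreeningProblem d) : Nonempty P.types := by
  obtain ⟨y, hy⟩ := P.typeCone_fullDim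
  obtain ⟨r, -, θ, hθ, -⟩ := interior_subset hy
  exact ⟨⟨θ, hθ⟩⟩

theorem convex_typeCone (P : ScreeningProblem d) : Convex ℝ (typeCone P.types) := by
  obtain ⟨N, -, hN⟩ := P.typeCone_polyhedral
  have h : typeCone P.types = ⋂ n ∈ N, {y | ⟪n, y⟫ ≤ 0} := by
    rw [hN]; ext; simp
  rw [h]
  exact convex_iInter₂ fun n _ => convex_halfSpace_le (innerₛₗ ℝ n).isLinear 0

/-- The support function of the range of a map on the type space. For a mechanism it extends the
indirect utility function to all of `ℝ^d`. -/
noncomputable def rangeSupport (P : ScreeningProblem d) (x : P.types → EucSp d) (y : EucSp d) : ℝ :=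
  ⨆ θ, ⟪x θ, y⟫

section rangeSupport

variable {P : ScreeningProblem d} {x : P.types → EucSp d}

theorem IsICIRMechanism.exists_norm_le (hx : P.IsICIRMechanism x) :
    ∃ R : NNReal, ∀ θ, ‖x θ‖ ≤ R := by
  obtain ⟨R, hR⟩ := P.isCompact_alloc.isBounded.exists_norm_le
  exact ⟨R.toNNReal, fun θ => (hR _ (hx.feasible θ)).trans (Real.le_coe_toNNReal R)⟩

theorem IsICIRMechanism.inner_le_rangeSupport (hx : P.IsICIRMechanism x) (θ : P.types)
    (y : EucSp d) : ⟪x θ, y⟫ ≤ P.rangeSupport x y := by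
  obtain ⟨R, hR⟩ := hx.exists_norm_le
  refine le_ciSup (f := fun θ => ⟪x θ, y⟫) ⟨R * ‖y‖, ?_⟩ θ
  rintro _ ⟨θ, rfl⟩
  exact (real_inner_le_norm _ _).trans (mul_le_mul_of_nonneg_right (hR θ) (norm_nonneg y))

theorem IsICIRMechanism.exists_lipschitzWith (hx : P.IsICIRMechanism x) :
    ∃ R, LipschitzWith R (P.rangeSupport x) := by
  have := P.types_nonempty
  obtain ⟨R, hR⟩ := hx.exists_norm_le
  refine ⟨R, LipschitzWith.of_le_add_mul R fun y z => ciSup_le fun θ => ?_⟩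
  have h1 := hx.inner_le_rangeSupport θ z
  have h2 : ⟪x θ, y - z⟫ ≤ R * dist y z := by
    rw [dist_eq_norm]
    exact (real_inner_le_norm _ _).trans (mul_le_mul_of_nonneg_right (hR θ) (norm_nonneg _))
  rw [inner_sub_right] at h2
  linarith

theorem IsICIRMechanism.rangeSupport_smul (hx : P.IsICIRMechanism x) {r : ℝ} (hr : 0 ≤ r)
    (θ : P.types) : P.rangeSupport x (r • (θ : EucSp d)) = r * P.payoff x θ := by
  have := P.types_nonempty
  apply le_antisymm
  · refine ciSup_le fun θ' => ?_
    rw [inner_smul_right]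
    exact mul_le_mul_of_nonneg_left (hx.ic θ θ') hr
  · have := hx.inner_le_rangeSupport θ (r • (θ : EucSp d))
    rwa [inner_smul_right] at this

theorem IsICIRMechanism.rangeSupport_type (hx : P.IsICIRMechanism x) (θ : P.types) :
    P.rangeSupport x θ = P.payoff x θ := by
  simpa using hx.rangeSupport_smul zero_le_one θ

theorem IsICIRMechanism.inner_le_of_compatible (hx : P.IsICIRMechanism x) {b : EucSp d}
    (hb : ∀ θ' : P.types, ⟪b, (θ' : EucSp d)⟫ ≤ P.payoff x θ') {z : EucSp d}
    (hz : z ∈ typeCone P.types) : ⟪b, z⟫ ≤ P.rangeSupport x z := by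
  obtain ⟨r, hr, θ, hθ, rfl⟩ := hz
  rw [hx.rangeSupport_smul hr ⟨θ, hθ⟩, inner_smul_right]
  exact mul_le_mul_of_nonneg_left (hb ⟨θ, hθ⟩) hr

/-- Where the indirect utility is differentiable, its gradient is a sharp point. -/
theorem IsICIRMechanism.sharp_of_differentiableAt (hx : P.IsICIRMechanism x) {y : EucSp d}
    (hy : y ∈ interior (typeCone P.types)) (hdiff : DifferentiableAt ℝ (P.rangeSupport x) y)
    {r : ℝ} (hr : 0 < r) {θ : P.types} (hyθ : y = r • (θ : EucSp d)) :
    x θ ∈ P.sharpPoints (P.payoff x) := by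
  have key : ∀ b : EucSp d, (∀ θ' : P.types, ⟪b, (θ' : EucSp d)⟫ ≤ P.payoff x θ') →
      ⟪b, (θ : EucSp d)⟫ = P.payoff x θ → fderiv ℝ (P.rangeSupport x) y = innerSL ℝ b := by
    intro b hb hbθ
    have hmin : IsLocalMin (fun z => P.rangeSupport x z - innerSL ℝ b z) y := by
      filter_upwards [isOpen_interior.mem_nhds hy] with z hz
      have h1 := hx.inner_le_of_compatible hb (interior_subset hz)
      have h2 : P.rangeSupport x y = ⟪b, y⟫ := by
        rw [hyθ, hx.rangeSupport_smul hr.le, inner_smul_right, hbθ]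
      simp only [innerSL_apply_apply, h2]
      linarith
    have h0 := hmin.hasFDerivAt_eq_zero (hdiff.hasFDerivAt.sub (innerSL ℝ b).hasFDerivAt)
    exact sub_eq_zero.mp h0
  refine ⟨θ, rfl, fun θ' => hx.ic θ' θ, fun b hb hbθ => ?_⟩
  have h := (key b hb hbθ).symm.trans (key (x θ) (fun θ' => hx.ic θ' θ) rfl)
  refine ext_inner_right ℝ fun v => ?_
  simpa using congrArg (fun f : EucSp d →L[ℝ] ℝ => f v) h

/-- If there are finitely many sharp points, every type gets its utility from one of them: by
Rademacher's theorem this holds for a dense set of types, and the maximum over a finite set of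
allocations is continuous in the type. -/
theorem IsICIRMechanism.exists_sharp (hx : P.IsICIRMechanism x)
    (hfin : (P.sharpPoints (P.payoff x)).Finite) (θ : P.types) :
    ∃ a ∈ P.sharpPoints (P.payoff x), ⟪a, (θ : EucSp d)⟫ = P.payoff x θ := by
  by_contra! hne
  obtain ⟨R, hlip⟩ := hx.exists_lipschitzWith
  set V : Set (EucSp d) :=
    (⋂ a ∈ P.sharpPoints (P.payoff x), {y | ⟪a, y⟫ < P.rangeSupport x y}) ∩ {0}ᶜ with hV
  have hVopen : IsOpen V := by
    refine IsOpen.inter (hfin.isOpen_biInter fun a _ => ?_) isOpen_compl_singleton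
    exact isOpen_lt (by fun_prop) hlip.continuous
  have hθV : (θ : EucSp d) ∈ V := by
    refine ⟨Set.mem_iInter₂.mpr fun a ha => ?_, fun h => P.zero_notMem_types (h ▸ θ.2)⟩
    rw [Set.mem_ofPred_eq, hx.rangeSupport_type]
    obtain ⟨_, _, h, _⟩ := id ha
    exact lt_of_le_of_ne (h θ) (hne a ha)
  have hθcl : (θ : EucSp d) ∈ closure (interior (typeCone P.types)) := by
    rw [P.convex_typeCone.closure_interior_eq_closure_of_nonempty_interior P.typeCone_fullDim]
    exact subset_closure ⟨1, zero_le_one, θ, θ.2, (one_smul _ _).symm⟩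
  have hdense : Dense {y | DifferentiableAt ℝ (P.rangeSupport x) y} :=
    MeasureTheory.Measure.dense_of_ae (hlip.ae_differentiableAt (μ := MeasureTheory.volume))
  obtain ⟨y, ⟨hyV, hyC⟩, hydiff⟩ := hdense.inter_open_nonempty _ (hVopen.inter isOpen_interior)
    (mem_closure_iff.mp hθcl V hVopen hθV)
  obtain ⟨r, hr, θ', hθ', hyθ'⟩ := id (interior_subset hyC)
  have hr0 : 0 < r := by
    refine lt_of_le_of_ne hr ?_
    rintro rfl
    exact hyV.2 (by simpa using hyθ')
  have hsharp := hx.sharp_of_differentiableAt hyC hydiff hr0 (θ := ⟨θ', hθ'⟩) hyθ'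
  have hlt := Set.mem_iInter₂.mp hyV.1 _ hsharp
  rw [Set.mem_ofPred_eq, hyθ', hx.rangeSupport_smul hr0.le ⟨θ', hθ'⟩, inner_smul_right] at hlt
  exact lt_irrefl _ hlt

end rangeSupport

/-- A measurable choice from a finite set, given measurable sets of admissible arguments. -/
theorem exists_measurable_selection {α β : Type*} [MeasurableSpace α] [MeasurableSpace β]
    [Nonempty β] {D : Set β} (hD : D.Finite) (B : β → Set α) (hB : ∀ a ∈ D, MeasurableSet (B a)) :
    ∃ f : α → β, Measurable f ∧ ∀ t, (∃ a ∈ D, t ∈ B a) → f t ∈ D ∧ t ∈ B (f t) := by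
  classical
  induction D, hD using Set.Finite.induction_on with
  | empty => exact ⟨fun _ => Classical.arbitrary β, measurable_const, by simp⟩
  | @insert a D _ _ ih =>
    obtain ⟨f, hf, hfD⟩ := ih fun b hb => hB b (Set.mem_insert_of_mem _ hb)
    refine ⟨(B a).piecewise (fun _ => a) f,
      Measurable.piecewise (hB a (Set.mem_insert _ _)) measurable_const hf, ?_⟩
    rintro t ⟨b, hb, htb⟩
    by_cases hta : t ∈ B a
    · simp [hta]
    · rw [Set.piecewise_eq_of_notMem _ _ _ hta]
      rcases hb with rfl | hb
      · exact absurd htb hta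
      · exact ⟨Set.mem_insert_of_mem _ (hfD t ⟨b, hb, htb⟩).1, (hfD t ⟨b, hb, htb⟩).2⟩

theorem IsICIRMechanism.exists_sharp_valued {P : ScreeningProblem d} {x : P.types → EucSp d}
    (hx : P.IsICIRMechanism x)
    (hfin : (P.sharpPoints (P.payoff x)).Finite) :
    ∃ x', P.IsICIRMechanism x' ∧ P.payoff x' = P.payoff x ∧
      ∀ θ, x' θ ∈ P.sharpPoints (P.payoff x) := by
  have hU : Measurable (P.payoff x) := hx.measurable.inner measurable_subtype_coe
  obtain ⟨f, hf, hfD⟩ := exists_measurable_selection hfin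
    (fun a => {θ : P.types | ⟪a, (θ : EucSp d)⟫ = P.payoff x θ}) (fun a _ =>
      measurableSet_eq_fun (measurable_const.inner measurable_subtype_coe) hU)
  have hf' := fun θ => hfD θ (hx.exists_sharp hfin θ)
  have hpay : P.payoff f = P.payoff x := funext fun θ => (hf' θ).2
  refine ⟨f, ⟨hf, fun θ => ?_, fun θ θ' => ?_, fun a ha θ => ?_⟩, hpay, fun θ => (hf' θ).1⟩
  · obtain ⟨θ', h⟩ := hx.mem_range_of_sharp (hf' θ).1
    exact h ▸ hx.feasible θ'
  · obtain ⟨_, _, h, _⟩ := (hf' θ').1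
    exact (h θ).trans (congrFun hpay θ).ge
  · exact (hx.ir a ha θ).trans (congrFun hpay θ).ge

theorem IsICIRMechanism.menu_eq {P : ScreeningProblem d} {x : P.types → EucSp d}
    (hx : P.IsICIRMechanism x)
    (hfin : (P.sharpPoints (P.payoff x)).Finite) :
    P.menu (P.toClass x) = P.sharpPoints (P.payoff x) := by
  have h : (⋂ y ∈ {y | P.IsICIRMechanism y ∧ P.toClass y = P.toClass x}, Set.range y)
      = P.sharpPoints (P.payoff x) := by
    apply subset_antisymm
    · obtain ⟨x', hx', hpay, hmem⟩ := hx.exists_sharp_valued hfin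
      have hmem' : x' ∈ {y | P.IsICIRMechanism y ∧ P.toClass y = P.toClass x} :=
        And.intro hx' ((P.toClass_eq_iff_payoff _ _).mpr hpay)
      intro a ha
      obtain ⟨θ, rfl⟩ := Set.mem_iInter₂.mp ha x' hmem'
      exact hmem θ
    · intro a ha
      refine Set.mem_iInter₂.mpr fun y hy => hy.1.mem_range_of_sharp ?_
      rwa [(P.toClass_eq_iff_payoff _ _).mp hy.2]
  rw [menu, h, hfin.isClosed.closure_eq]

/-! ### Perturbations of extreme mechanisms -/

/-- An extreme mechanism admits no perturbation in two opposite directions that respects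
feasibility and incentive compatibility. Participation is automatic: a type whose favorite
allocation is the veto allocation gets its maximal feasible utility, which feasible opposite
perturbations cannot change, and participation of these types is all that matters. -/
theorem inner_eq_zero_of_mem_extremePoints {P : ScreeningProblem 2} {x w : P.types → EucSp 2}
    (hx : P.IsICIRMechanism x) (hext : P.toClass x ∈ P.mechanisms.extremePoints ℝ)
    (hw : Measurable w) (hfeas : ∀ θ, x θ + w θ ∈ P.alloc) (hfeas' : ∀ θ, x θ - w θ ∈ P.alloc)
    (hic : ∀ θ θ' : P.types, ⟪x θ' + w θ', (θ : EucSp 2)⟫ ≤ ⟪x θ + w θ, (θ : EucSp 2)⟫)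
    (hic' : ∀ θ θ' : P.types, ⟪x θ' - w θ', (θ : EucSp 2)⟫ ≤ ⟪x θ - w θ, (θ : EucSp 2)⟫)
    (θ : P.types) : ⟪w θ, (θ : EucSp 2)⟫ = 0 := by
  have hzero : ∀ a ∈ P.veto, ∀ θ : P.types,
      (∀ b ∈ P.alloc, ⟪b, (θ : EucSp 2)⟫ ≤ ⟪a, (θ : EucSp 2)⟫) →
      ⟪w θ, (θ : EucSp 2)⟫ = 0 := by
    intro a ha θ hθ
    have h1 := hθ _ (hfeas θ)
    have h2 := hθ _ (hfeas' θ)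
    have h3 := hx.ir a ha θ
    rw [inner_add_left] at h1
    rw [inner_sub_left] at h2
    linarith
  have h1 : P.IsICIRMechanism (x + w) := by
    refine ⟨hx.measurable.add hw, hfeas, hic, fun a ha => P.ir_of_favorite ha hfeas hic ?_⟩
    intro θ hθ
    rw [Pi.add_apply, inner_add_left, hzero a ha θ hθ, add_zero]
    exact hx.ir a ha θ
  have h2 : P.IsICIRMechanism (x - w) := by
    refine ⟨hx.measurable.sub hw, hfeas', hic', fun a ha => P.ir_of_favorite ha hfeas' hic' ?_⟩
    intro θ hθ
    rw [Pi.sub_apply, inner_sub_left, hzero a ha θ hθ, sub_zero]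
    exact hx.ir a ha θ
  have hseg : P.toClass x ∈ openSegment ℝ (P.toClass (x + w)) (P.toClass (x - w)) := by
    refine ⟨1 / 2, 1 / 2, by norm_num, by norm_num, by norm_num, ?_⟩
    rw [toClass, toClass, toClass, ← map_smul, ← map_smul, ← map_add]
    congr 1
    module
  have heq := hext.2 ⟨_, h1, rfl⟩ ⟨_, h2, rfl⟩ hseg
  have := (P.toClass_eq_iff _ _).mp heq θ
  rwa [Pi.add_apply, inner_add_left, add_eq_left] at this

end ScreeningProblem

/-! ### The boundary of a planar convex set by outer normals -/

/-- The vector at angle `α` from `e`. -/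
noncomputable def dirVec (e : EucSp 2) (α : ℝ) : EucSp 2 :=
  Real.cos α • e + Real.sin α • rotate e

/-- The angle in `(-π, π]` from `e` to `y`. -/
noncomputable def angleFrom (e y : EucSp 2) : ℝ :=
  Complex.arg ⟨⟪y, e⟫, ⟪y, rotate e⟫⟩

theorem angleFrom_mem_Ioc (e y : EucSp 2) : angleFrom e y ∈ Set.Ioc (-Real.pi) Real.pi :=
  Complex.arg_mem_Ioc _

theorem measurable_angleFrom (e : EucSp 2) : Measurable (angleFrom e) := by
  have h : angleFrom e = fun y =>
      Complex.arg ((⟪y, e⟫ : ℝ) + (⟪y, rotate e⟫ : ℝ) * Complex.I) := by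
    funext y
    rw [angleFrom, Complex.mk_eq_add_mul_I]
  rw [h]
  refine Complex.measurable_arg.comp (Continuous.measurable ?_)
  fun_prop

theorem angleFrom_neg_self {y : EucSp 2} (hy : y ≠ 0) : angleFrom (-y) y = Real.pi := by
  have h1 : ⟪y, rotate (-y)⟫ = 0 := by rw [inner_two]; simp; ring
  have h2 : ⟪y, -y⟫ < 0 := by
    rw [inner_neg_right]
    have := real_inner_self_pos.mpr hy
    linarith
  rw [angleFrom, h1, Complex.arg_eq_pi_iff]
  exact ⟨h2, rfl⟩

theorem exists_eq_smul_dirVec {e y : EucSp 2} (he : e ≠ 0) (hy : y ≠ 0) :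
    ∃ ρ : ℝ, 0 < ρ ∧ y = ρ • dirVec e (angleFrom e y) := by
  set z : ℂ := ⟨⟪y, e⟫, ⟪y, rotate e⟫⟩ with hz
  have hee : 0 < e 0 * e 0 + e 1 * e 1 := by
    rw [← inner_two]
    exact real_inner_self_pos.mpr he
  have hre : ‖z‖ * Real.cos (Complex.arg z) = y 0 * e 0 + y 1 * e 1 := by
    rw [Complex.norm_mul_cos_arg, hz, inner_two]
  have him : ‖z‖ * Real.sin (Complex.arg z) = y 1 * e 0 - y 0 * e 1 := by
    rw [Complex.norm_mul_sin_arg]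
    change ⟪y, rotate e⟫ = _
    rw [inner_two, rotate_zero_apply, rotate_one_apply]
    ring
  have heq : y = (‖z‖ / (e 0 * e 0 + e 1 * e 1)) • dirVec e (angleFrom e y) := by
    have hang : angleFrom e y = Complex.arg z := rfl
    rw [hang, dirVec]
    ext i
    fin_cases i
    · simp only [PiLp.smul_apply, PiLp.add_apply, smul_eq_mul, Fin.zero_eta, rotate_zero_apply]
      rw [div_mul_eq_mul_div, eq_div_iff hee.ne']
      linear_combination -e 0 * hre + e 1 * him
    · simp only [PiLp.smul_apply, PiLp.add_apply, smul_eq_mul, Fin.mk_one, rotate_one_apply]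
      rw [div_mul_eq_mul_div, eq_div_iff hee.ne']
      linear_combination -e 1 * hre - e 0 * him
  refine ⟨_, lt_of_le_of_ne (div_nonneg (norm_nonneg z) hee.le) fun h => hy ?_, heq⟩
  rw [heq, ← h, zero_smul]

theorem dirVec_add_two_pi (e : EucSp 2) (α : ℝ) : dirVec e (α + 2 * Real.pi) = dirVec e α := by
  simp [dirVec]

theorem dirVec_sub_two_pi (e : EucSp 2) (α : ℝ) : dirVec e (α - 2 * Real.pi) = dirVec e α := by
  simp [dirVec]

theorem sin_mul_inner_dirVec (e v : EucSp 2) (α β γ : ℝ) :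
    Real.sin (β - α) * ⟪v, dirVec e γ⟫ =
      Real.sin (β - γ) * ⟪v, dirVec e α⟫ - Real.sin (α - γ) * ⟪v, dirVec e β⟫ := by
  simp only [dirVec, inner_add_right, inner_smul_right, Real.sin_sub]
  ring

/-- The point `a` of `E` maximizes the linear functional in direction `α` over `E`. The pairs
`(α, a)` describe the boundary of the convex hull of `E` by its outer normals. -/
def IsSupport (E : Set (EucSp 2)) (e : EucSp 2) (α : ℝ) (a : EucSp 2) : Prop :=
  a ∈ E ∧ ∀ b ∈ E, ⟪b, dirVec e α⟫ ≤ ⟪a, dirVec e α⟫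

namespace IsSupport

variable {E : Set (EucSp 2)} {e a b : EucSp 2} {α β γ : ℝ}

theorem add_two_pi (h : IsSupport E e α a) : IsSupport E e (α + 2 * Real.pi) a := by
  rwa [IsSupport, dirVec_add_two_pi]

theorem sub_two_pi (h : IsSupport E e α a) : IsSupport E e (α - 2 * Real.pi) a := by
  rwa [IsSupport, dirVec_sub_two_pi]

/-- Moving counterclockwise along the boundary for at most half a turn, starting at direction `γ` or
later, does not increase the functional in direction `γ`. -/
theorem inner_le_of_forward (ha : IsSupport E e α a) (hb : IsSupport E e β b) (h1 : γ ≤ α)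
    (h2 : α < β ∨ a = b) (h3 : β ≤ γ + Real.pi) : ⟪b, dirVec e γ⟫ ≤ ⟪a, dirVec e γ⟫ := by
  rcases h2 with h2 | rfl
  · have hα : ⟪b - a, dirVec e α⟫ ≤ 0 := by
      rw [inner_sub_left]; linarith [ha.2 b hb.1]
    have hβ : 0 ≤ ⟪b - a, dirVec e β⟫ := by
      rw [inner_sub_left]; linarith [hb.2 a ha.1]
    rcases h3.lt_or_eq with h3 | h3
    · have hsin : 0 < Real.sin (β - α) := Real.sin_pos_of_pos_of_lt_pi (by linarith) (by linarith)
      have h4 : 0 ≤ Real.sin (β - γ) :=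
        Real.sin_nonneg_of_nonneg_of_le_pi (by linarith) (by linarith)
      have h5 : 0 ≤ Real.sin (α - γ) :=
        Real.sin_nonneg_of_nonneg_of_le_pi (by linarith) (by linarith)
      have h6 := sin_mul_inner_dirVec e (b - a) α β γ
      have h7 : Real.sin (β - α) * ⟪b - a, dirVec e γ⟫ ≤ 0 := by
        rw [h6]
        nlinarith [mul_nonneg h5 hβ, mul_nonneg h4 (neg_nonneg.mpr hα)]
      have h8 := nonpos_of_mul_nonpos_right h7 hsin
      rw [inner_sub_left] at h8
      linarith
    · have hneg : dirVec e β = -dirVec e γ := by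
        rw [h3, dirVec, dirVec, Real.cos_add_pi, Real.sin_add_pi]; module
      rw [hneg, inner_neg_right, inner_sub_left] at hβ
      linarith
  · exact le_rfl

/-- Moving counterclockwise along the boundary for at most half a turn, ending at direction `γ` or
earlier, does not decrease the functional in direction `γ`. -/
theorem inner_le_of_backward (ha : IsSupport E e α a) (hb : IsSupport E e β b)
    (h1 : γ ≤ α + Real.pi) (h2 : α < β ∨ a = b) (h3 : β ≤ γ) :
    ⟪a, dirVec e γ⟫ ≤ ⟪b, dirVec e γ⟫ := by
  have h := inner_le_of_forward (γ := γ - Real.pi) ha hb (by linarith) h2 (by linarith)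
  have hneg : dirVec e (γ - Real.pi) = -dirVec e γ := by
    rw [dirVec, dirVec, Real.cos_sub_pi, Real.sin_sub_pi]; module
  rw [hneg, inner_neg_right, inner_neg_right] at h
  linarith

end IsSupport

/-- The displacement from the point `m` met at angle `σ` to the point `a` met at angle `α` when the
boundary is traversed counterclockwise, and zero before `σ`. -/
noncomputable def truncation (σ : ℝ) (m : EucSp 2) (α : ℝ) (a : EucSp 2) : EucSp 2 :=
  if σ < α then a - m else 0

/-- The correction for directions more than half a turn apart, for which the short way from one to
the other passes the cut at angle `π`. -/
noncomputable def windingSign (α β : ℝ) : ℝ :=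
  if β + Real.pi < α then -1 else if α + Real.pi < β then 1 else 0

/-- Truncated displacements are monotone, and so are their complements: between two boundary
points the truncated displacement, corrected for winding, lies in the part of the short boundary
arc between them that is beyond `σ`. -/
theorem inner_truncation_sub_mem_Icc {E : Set (EucSp 2)} {e a b m m₀ : EucSp 2} {α β σ : ℝ}
    (ha : IsSupport E e α a) (hb : IsSupport E e β b)
    (hα : α ∈ Set.Ioc (-Real.pi) Real.pi) (hβ : β ∈ Set.Ioc (-Real.pi) Real.pi)
    (hm : IsSupport E e σ m) (hσ : σ ∈ Set.Ioo (-Real.pi) Real.pi)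
    (hm' : ∀ c, IsSupport E e σ c → c = m)
    (hm₀ : IsSupport E e Real.pi m₀) (hm₀' : ∀ c, IsSupport E e Real.pi c → c = m₀) :
    ⟪truncation σ m α a - truncation σ m β b + windingSign α β • (m₀ - m), dirVec e α⟫ ∈
      Set.Icc 0 ⟪a - b, dirVec e α⟫ := by
  obtain ⟨hα1, hα2⟩ := hα
  obtain ⟨hβ1, hβ2⟩ := hβ
  obtain ⟨hσ1, hσ2⟩ := hσ
  have hab := ha.2 b hb.1
  have ham := ha.2 m hm.1
  have ham₀ := ha.2 m₀ hm₀.1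
  have hm₀neg : IsSupport E e (-Real.pi) m₀ := by
    have := hm₀.sub_two_pi
    rwa [show Real.pi - 2 * Real.pi = -Real.pi by ring] at this
  have hβσ : β ≤ σ → β < σ ∨ b = m := fun h =>
    h.lt_or_eq.imp_right fun h : β = σ => hm' b (h ▸ hb)
  have hβπ : β < Real.pi ∨ b = m₀ := 
    hβ2.lt_or_eq.imp_right fun h : β = Real.pi => hm₀' b (h ▸ hb)
  unfold truncation windingSign
  rcases lt_or_ge (β + Real.pi) α with hw | hw
  · -- the short way from `α` to `β` is counterclockwise through the cut
    have fwd : ∀ {p q : EucSp 2} {s t : ℝ}, IsSupport E e s p → IsSupport E e t q →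
        -Real.pi ≤ s → (s < t ∨ p = q) → t ≤ β → ⟪q, dirVec e α⟫ ≤ ⟪p, dirVec e α⟫ := by
      intro p q s t hp hq h1 h2 h3
      have := hp.inner_le_of_forward hq (γ := α - 2 * Real.pi) (by linarith) h2 (by linarith)
      rwa [dirVec_sub_two_pi] at this
    have k1 := fwd hm₀neg hb le_rfl (Or.inl hβ1) le_rfl
    rw [if_pos hw]
    split_ifs with h1 h2 h2
    · have k2 := fwd hm hb hσ1.le (Or.inl h2) le_rfl
      have k3 := fwd hm₀neg hm le_rfl (Or.inl hσ1) h2.le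
      constructor <;>
        simp only [inner_add_left, inner_sub_left, real_inner_smul_left] <;> linarith
    · constructor <;>
        simp only [inner_add_left, inner_sub_left, real_inner_smul_left, inner_zero_left] <;>
        linarith
    · linarith
    · have k2 := hm.inner_le_of_forward hm₀ (γ := α) (by linarith) (Or.inl hσ2) (by linarith)
      constructor <;>
        simp only [inner_add_left, inner_sub_left, real_inner_smul_left, inner_zero_left] <;>
        linarith
  rw [if_neg (not_lt.mpr hw)]
  rcases lt_or_ge (α + Real.pi) β with hw' | hw'
  · -- the short way from `β` to `α` is counterclockwise through the cut
    have bwd : ∀ {p q : EucSp 2} {s t : ℝ}, IsSupport E e s p → IsSupport E e t q →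
        β ≤ s → (s < t ∨ p = q) → t ≤ α + 2 * Real.pi →
        ⟪p, dirVec e α⟫ ≤ ⟪q, dirVec e α⟫ := by
      intro p q s t hp hq h1 h2 h3
      have := hp.inner_le_of_backward hq (γ := α + 2 * Real.pi) (by linarith) h2 (by linarith)
      rwa [dirVec_add_two_pi] at this
    have k1 := bwd hb hm₀ le_rfl hβπ (by linarith)
    rw [if_pos hw']
    split_ifs with h1 h2 h2
    · have k2 := bwd hm₀ hm.add_two_pi (by linarith) (Or.inl (by linarith)) (by linarith)
      constructor <;>
        simp only [inner_add_left, inner_sub_left, real_inner_smul_left] <;> linarith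
    · linarith
    · constructor <;>
        simp only [inner_add_left, inner_sub_left, real_inner_smul_left, inner_zero_left] <;>
        linarith
    · have k2 := bwd hb hm le_rfl (hβσ (by linarith)) (by linarith)
      have k3 := bwd hm hm₀ (by linarith) (Or.inl hσ2) (by linarith)
      constructor <;>
        simp only [inner_add_left, inner_sub_left, real_inner_smul_left, inner_zero_left] <;>
        linarith
  rw [if_neg (not_lt.mpr hw')]
  split_ifs with h1 h2 h2
  · constructor <;>
      simp only [inner_add_left, inner_sub_left, real_inner_smul_left] <;> linarith
  · have k2 := hb.inner_le_of_backward hm (γ := α) (by linarith) (hβσ (by linarith)) h1.le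
    constructor <;>
      simp only [inner_add_left, inner_sub_left, real_inner_smul_left, inner_zero_left] <;>
      linarith
  · have k2 := hm.inner_le_of_forward hb (γ := α) (by linarith) (Or.inl h2) (by linarith)
    constructor <;>
      simp only [inner_add_left, inner_sub_left, real_inner_smul_left, inner_zero_left] <;>
      linarith
  · constructor <;>
      simp only [inner_add_left, inner_sub_left, real_inner_smul_left, inner_zero_left] <;>
      linarith

/-! ### Piecewise homothetic displacements of the boundary -/

/-- Marked boundary points of the convex hull of `E`, one at angle `π` and one for each element of
`ι`. Each is the only point of `E` that is extremal in its direction. -/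
structure Markers (E : Set (EucSp 2)) (e : EucSp 2) (ι : Type*) where
  top : EucSp 2
  pt : ι → EucSp 2
  ang : ι → ℝ
  top_support : IsSupport E e Real.pi top
  top_unique : ∀ c, IsSupport E e Real.pi c → c = top
  support : ∀ i, IsSupport E e (ang i) (pt i)
  unique : ∀ i c, IsSupport E e (ang i) c → c = pt i
  ang_mem : ∀ i, ang i ∈ Set.Ioo (-Real.pi) Real.pi
  pt_injective : Function.Injective pt
  pt_ne_top : ∀ i, pt i ≠ top

namespace Markers

variable {E : Set (EucSp 2)} {e : EucSp 2} {ι : Type*} [Fintype ι]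

/-- The displacement field on the boundary with parameters `q = (t, d, c)`: translation by `t`, a
homothety of ratio `d`, and, for each `i`, a homothety of ratio `c i` applied to the part of the
boundary between the `i`-th marker and the marker at angle `π`. -/
noncomputable def field (M : Markers E e ι) (α : ℝ) (a : EucSp 2) :
    (EucSp 2 × ℝ × (ι → ℝ)) →ₗ[ℝ] EucSp 2 where
  toFun q := q.1 + q.2.1 • a + ∑ i, q.2.2 i • truncation (M.ang i) (M.pt i) α a
  map_add' p q := by
    simp only [Prod.fst_add, Prod.snd_add, Pi.add_apply, add_smul, Finset.sum_add_distrib]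
    abel
  map_smul' r q := by
    simp only [Prod.smul_fst, Prod.smul_snd, Pi.smul_apply, smul_eq_mul, mul_smul,
      ← Finset.smul_sum, smul_add, RingHom.id_apply]

/-- The net displacement that the local homotheties accumulate over one full turn. -/
noncomputable def defect (M : Markers E e ι) : (EucSp 2 × ℝ × (ι → ℝ)) →ₗ[ℝ] EucSp 2 where
  toFun q := ∑ i, q.2.2 i • (M.top - M.pt i)
  map_add' p q := by
    simp only [Prod.snd_add, Pi.add_apply, add_smul, Finset.sum_add_distrib]
  map_smul' r q := by
    simp only [Prod.smul_snd, Pi.smul_apply, smul_eq_mul, mul_smul, ← Finset.smul_sum,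
      RingHom.id_apply]

theorem field_apply (M : Markers E e ι) (α : ℝ) (a : EucSp 2) (q : EucSp 2 × ℝ × (ι → ℝ)) :
    M.field α a q = q.1 + q.2.1 • a + ∑ i, q.2.2 i • truncation (M.ang i) (M.pt i) α a := rfl

theorem defect_apply (M : Markers E e ι) (q : EucSp 2 × ℝ × (ι → ℝ)) :
    M.defect q = ∑ i, q.2.2 i • (M.top - M.pt i) := rfl

theorem measurable_field (M : Markers E e ι) (q : EucSp 2 × ℝ × (ι → ℝ)) {Ω : Type*}
    [MeasurableSpace Ω] {f : Ω → ℝ} {x : Ω → EucSp 2} (hf : Measurable f) (hx : Measurable x) :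
    Measurable fun ω => M.field (f ω) (x ω) q := by
  have htrunc : ∀ i, Measurable fun ω => truncation (M.ang i) (M.pt i) (f ω) (x ω) := fun i =>
    Measurable.ite (measurableSet_lt measurable_const hf) (hx.sub_const _) measurable_const
  have hsum : Measurable fun ω => ∑ i, q.2.2 i • truncation (M.ang i) (M.pt i) (f ω) (x ω) :=
    Finset.measurable_fun_sum _ fun i _ => (htrunc i).const_smul (q.2.2 i)
  have hlin : Measurable fun ω => q.1 + q.2.1 • x ω := (hx.const_smul q.2.1).const_add q.1
  exact hlin.add hsum

/-- A displacement field that closes up is dominated by the boundary itself. -/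
theorem abs_inner_field_sub_le (M : Markers E e ι) {q : EucSp 2 × ℝ × (ι → ℝ)}
    (hq : M.defect q = 0) {a b : EucSp 2} {α β : ℝ} (ha : IsSupport E e α a)
    (hb : IsSupport E e β b) (hα : α ∈ Set.Ioc (-Real.pi) Real.pi)
    (hβ : β ∈ Set.Ioc (-Real.pi) Real.pi) :
    |⟪M.field α a q - M.field β b q, dirVec e α⟫| ≤
      (|q.2.1| + ∑ i, |q.2.2 i|) * ⟪a - b, dirVec e α⟫ := by
  have heq : M.field α a q - M.field β b q = q.2.1 • (a - b) +
      ∑ i, q.2.2 i • (truncation (M.ang i) (M.pt i) α a - truncation (M.ang i) (M.pt i) β b +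
        windingSign α β • (M.top - M.pt i)) := by
    have h0 : ∑ i, q.2.2 i • windingSign α β • (M.top - M.pt i) = 0 := by
      simp_rw [smul_comm _ (windingSign α β)]
      rw [← Finset.smul_sum, ← defect_apply, hq, smul_zero]
    have hsplit : ∀ i, q.2.2 i • (truncation (M.ang i) (M.pt i) α a -
        truncation (M.ang i) (M.pt i) β b + windingSign α β • (M.top - M.pt i)) =
        q.2.2 i • truncation (M.ang i) (M.pt i) α a -
          q.2.2 i • truncation (M.ang i) (M.pt i) β b +
          q.2.2 i • windingSign α β • (M.top - M.pt i) := fun i => by rw [smul_add, smul_sub]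
    rw [Finset.sum_congr rfl fun i _ => hsplit i, Finset.sum_add_distrib, Finset.sum_sub_distrib,
      h0, field_apply, field_apply, smul_sub]
    abel
  have hbd := fun i => inner_truncation_sub_mem_Icc ha hb hα hβ (M.support i) (M.ang_mem i)
    (M.unique i) M.top_support M.top_unique
  have hab : 0 ≤ ⟪a - b, dirVec e α⟫ := by
    rw [inner_sub_left]; linarith [ha.2 b hb.1]
  rw [heq, inner_add_left, real_inner_smul_left, sum_inner, add_mul, Finset.sum_mul]
  refine (abs_add_le _ _).trans (add_le_add ?_ ((Finset.abs_sum_le_sum_abs _ _).trans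
    (Finset.sum_le_sum fun i _ => ?_)))
  · rw [abs_mul, abs_of_nonneg hab]
  · rw [real_inner_smul_left, abs_mul, abs_of_nonneg (hbd i).1]
    exact mul_le_mul_of_nonneg_left (hbd i).2 (abs_nonneg _)

/-- Small multiples of a displacement field that closes up preserve the order of the boundary, so
the displaced boundary is again convex. -/
theorem inner_add_smul_field_le (M : Markers E e ι) {q : EucSp 2 × ℝ × (ι → ℝ)}
    (hq : M.defect q = 0) {s : ℝ} (hs : |s| * (|q.2.1| + ∑ i, |q.2.2 i|) ≤ 1)
    {a b : EucSp 2} {α β : ℝ} (ha : IsSupport E e α a) (hb : IsSupport E e β b)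
    (hα : α ∈ Set.Ioc (-Real.pi) Real.pi) (hβ : β ∈ Set.Ioc (-Real.pi) Real.pi) :
    ⟪b + s • M.field β b q, dirVec e α⟫ ≤ ⟪a + s • M.field α a q, dirVec e α⟫ := by
  have h := M.abs_inner_field_sub_le hq ha hb hα hβ
  have hab : 0 ≤ ⟪a - b, dirVec e α⟫ := by
    rw [inner_sub_left]; linarith [ha.2 b hb.1]
  have h1 : |s * ⟪M.field α a q - M.field β b q, dirVec e α⟫| ≤ ⟪a - b, dirVec e α⟫ := by
    rw [abs_mul]
    calc |s| * |⟪M.field α a q - M.field β b q, dirVec e α⟫|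
        ≤ |s| * ((|q.2.1| + ∑ i, |q.2.2 i|) * ⟪a - b, dirVec e α⟫) :=
          mul_le_mul_of_nonneg_left h (abs_nonneg s)
      _ = (|s| * (|q.2.1| + ∑ i, |q.2.2 i|)) * ⟪a - b, dirVec e α⟫ := by ring
      _ ≤ 1 * ⟪a - b, dirVec e α⟫ := mul_le_mul_of_nonneg_right hs hab
      _ = _ := one_mul _
  have h2 := (abs_le.mp h1).1
  rw [inner_sub_left] at h2
  rw [inner_sub_left] at h2
  rw [inner_add_left, inner_add_left, real_inner_smul_left, real_inner_smul_left]
  linarith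

/-- A displacement field that closes up and fixes all markers vanishes. -/
theorem eq_zero_of_field_eq_zero [Nonempty ι] (M : Markers E e ι) {q : EucSp 2 × ℝ × (ι → ℝ)}
    (hq : M.defect q = 0) (htop : M.field Real.pi M.top q = 0)
    (h : ∀ i, M.field (M.ang i) (M.pt i) q = 0) : q = 0 := by
  classical
  obtain ⟨t, d, c⟩ := q
  have hinj : ∀ i j, M.ang i = M.ang j → i = j := fun i j hij =>
    M.pt_injective (M.unique j _ (hij ▸ M.support i))
  simp only [field_apply] at htop h
  simp only [defect_apply] at hq
  have htop' : t + d • M.top = 0 := by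
    have : ∑ i, c i • truncation (M.ang i) (M.pt i) Real.pi M.top = 0 := by
      rw [← hq]
      exact Finset.sum_congr rfl fun i _ => by rw [truncation, if_pos (M.ang_mem i).2]
    rwa [this, add_zero] at htop
  -- no local homothety acts on the first marker
  obtain ⟨i₁, -, hi₁⟩ := Finset.exists_min_image Finset.univ M.ang Finset.univ_nonempty
  have h1 : t + d • M.pt i₁ = 0 := by
    have : ∑ i, c i • truncation (M.ang i) (M.pt i) (M.ang i₁) (M.pt i₁) = 0 :=
      Finset.sum_eq_zero fun i hi => by
        rw [truncation, if_neg (not_lt.mpr (hi₁ i hi)), smul_zero]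
    have h' := h i₁
    rwa [this, add_zero] at h'
  have hd : d = 0 := by
    have : d • (M.pt i₁ - M.top) = 0 := by
      rw [smul_sub, sub_eq_zero]
      exact add_left_cancel (h1.trans htop'.symm)
    exact (smul_eq_zero.mp this).resolve_right (sub_ne_zero.mpr (M.pt_ne_top i₁))
  have ht : t = 0 := by simpa [hd] using htop'
  subst hd ht
  -- the first active homothety moves the next marker
  have hc : c = 0 := by
    by_contra hne
    obtain ⟨j₀, hj₀⟩ := Function.ne_iff.mp hne
    obtain ⟨j, hj, hjmin⟩ := Finset.exists_min_image {i : ι | c i ≠ 0} M.ang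
      ⟨j₀, by simpa using hj₀⟩
    have hcj : c j ≠ 0 := by simpa using hj
    by_cases hnext : ∃ i, M.ang j < M.ang i
    · obtain ⟨i₀, hi₀⟩ := hnext
      obtain ⟨i, hi, himin⟩ := Finset.exists_min_image {i : ι | M.ang j < M.ang i} M.ang
        ⟨i₀, by simpa using hi₀⟩
      have hji : M.ang j < M.ang i := by simpa using hi
      have hsum := h i
      rw [zero_smul, add_zero, zero_add, Finset.sum_eq_single j] at hsum
      · rw [truncation, if_pos hji, smul_eq_zero, sub_eq_zero] at hsum
        exact hji.ne' (congrArg M.ang (M.pt_injective (hsum.resolve_left hcj)))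
      · intro l _ hlj
        by_cases hcl : c l = 0
        · rw [hcl, zero_smul]
        · have h2 : M.ang j < M.ang l :=
            lt_of_le_of_ne (hjmin l (by simpa using hcl)) fun h' => hlj (hinj _ _ h').symm
          rw [truncation, if_neg (not_lt.mpr (himin l (by simpa using h2))), smul_zero]
      · simp
    · push Not at hnext
      rw [Finset.sum_eq_single j] at hq
      · exact M.pt_ne_top j (sub_eq_zero.mp ((smul_eq_zero.mp hq).resolve_left hcj)).symm
      · intro l _ hlj
        by_cases hcl : c l = 0
        · rw [hcl, zero_smul]
        · exact absurd (hinj _ _ (le_antisymm (hnext l) (hjmin l (by simpa using hcl)))) hlj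
      · simp
  rw [hc]
  rfl

/-- With one marker more than linear constraints, a nonzero displacement field closes up and
satisfies all constraints. -/
theorem exists_ne_zero (M : Markers E e ι) (f : ι → (EucSp 2 × ℝ × (ι → ℝ)) →ₗ[ℝ] ℝ) :
    ∃ q, q ≠ 0 ∧ M.defect q = 0 ∧ ∀ i, f i q = 0 := by
  have hrank : Module.finrank ℝ (EucSp 2 × (ι → ℝ)) <
      Module.finrank ℝ (EucSp 2 × ℝ × (ι → ℝ)) := by
    simp only [Module.finrank_prod, Module.finrank_fintype_fun_eq_card, Module.finrank_self]
    omega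
  obtain ⟨q, hq, hq0⟩ := Submodule.exists_mem_ne_zero_of_ne_bot
    (LinearMap.ker_ne_bot_of_finrank_lt (f := M.defect.prod (LinearMap.pi f)) hrank)
  exact ⟨q, hq0, congrArg Prod.fst hq, fun i => congrFun (congrArg Prod.snd hq) i⟩

end Markers

/-! ### Counting sharp points -/

namespace ScreeningProblem

theorem IsICIRMechanism.inner_le_of_mem_closure_range {d : ℕ} {P : ScreeningProblem d}
    {x : P.types → EucSp d} (hx : P.IsICIRMechanism x) {b : EucSp d}
    (hb : b ∈ closure (Set.range x)) (θ : P.types) : ⟪b, (θ : EucSp d)⟫ ≤ P.payoff x θ := by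
  have hcl : IsClosed {b : EucSp d | ⟪b, (θ : EucSp d)⟫ ≤ P.payoff x θ} :=
    isClosed_le (by fun_prop) continuous_const
  refine hcl.closure_subset_iff.mpr ?_ hb
  rintro _ ⟨θ', rfl⟩
  exact hx.ic θ θ'

variable {P : ScreeningProblem 2} {x : P.types → EucSp 2} {e : EucSp 2}

theorem IsICIRMechanism.isSupport (hx : P.IsICIRMechanism x) (he : e ≠ 0) (θ : P.types) :
    IsSupport (closure (Set.range x)) e (angleFrom e θ) (x θ) := by
  refine ⟨subset_closure ⟨θ, rfl⟩, fun b hb => ?_⟩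
  obtain ⟨ρ, hρ, hθ⟩ := exists_eq_smul_dirVec he fun h => P.zero_notMem_types (h ▸ θ.2)
  have h := hx.inner_le_of_mem_closure_range hb θ
  rw [payoff] at h
  generalize x θ = a at h ⊢
  rw [hθ, inner_smul_right, inner_smul_right] at h
  exact le_of_mul_le_mul_left h hρ

theorem IsICIRMechanism.eq_of_isSupport (hx : P.IsICIRMechanism x) (he : e ≠ 0) {θ : P.types}
    (hsharp : ∀ b : EucSp 2, (∀ θ' : P.types, ⟪b, (θ' : EucSp 2)⟫ ≤ P.payoff x θ') →
      ⟪b, (θ : EucSp 2)⟫ = P.payoff x θ → b = x θ) {c : EucSp 2}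
    (hc : IsSupport (closure (Set.range x)) e (angleFrom e θ) c) : c = x θ := by
  have hle := hx.inner_le_of_mem_closure_range hc.1
  refine hsharp c hle (le_antisymm (hle θ) ?_)
  obtain ⟨ρ, hρ, hθ⟩ := exists_eq_smul_dirVec he fun h => P.zero_notMem_types (h ▸ θ.2)
  have h := hc.2 (x θ) (subset_closure ⟨θ, rfl⟩)
  rw [payoff]
  generalize x θ = a at h ⊢
  rw [hθ, inner_smul_right, inner_smul_right]
  exact mul_le_mul_of_nonneg_left h hρ.le

/-- For an extreme mechanism, a displacement field that closes up and is tangent to every facet at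
a point where the boundary is extremal in the direction of the facet fixes all points that are
sharp. -/
theorem field_eq_zero_of_sharp {ι : Type*} [Fintype ι] (hx : P.IsICIRMechanism x)
    (hext : P.toClass x ∈ P.mechanisms.extremePoints ℝ) (he : e ≠ 0)
    (M : Markers (closure (Set.range x)) e ι) {q : EucSp 2 × ℝ × (ι → ℝ)} (hq : M.defect q = 0)
    (hfacet : ∀ H ∈ P.facetHyperplanes, ∃ (n : EucSp 2) (c : ℝ) (b : EucSp 2), n ≠ 0 ∧
      H = {z | ⟪n, z⟫ = c} ∧ (∀ a ∈ P.alloc, ⟪n, a⟫ ≤ c) ∧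
      IsSupport (closure (Set.range x)) e (angleFrom e n) b ∧
      ⟪n, M.field (angleFrom e n) b q⟫ = 0)
    {θ : P.types}
    (hsharp : ∀ b : EucSp 2, (∀ θ' : P.types, ⟪b, (θ' : EucSp 2)⟫ ≤ P.payoff x θ') →
      ⟪b, (θ : EucSp 2)⟫ = P.payoff x θ → b = x θ) :
    M.field (angleFrom e θ) (x θ) q = 0 := by
  set K : ℝ := |q.2.1| + ∑ i, |q.2.2 i|
  have hK0 : 0 ≤ K := add_nonneg (abs_nonneg _) (Finset.sum_nonneg fun i _ => abs_nonneg _)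
  -- `K` bounds the displacement relative to the boundary, so multiples up to `1 / K` keep convexity
  set ε : ℝ := (K + 1)⁻¹ with hε
  have hε0 : 0 < ε := inv_pos.mpr (by linarith)
  have hεK : ε * K ≤ 1 := by
    rw [hε, inv_mul_le_iff₀ (by linarith)]
    linarith
  obtain ⟨V, hV⟩ : ∃ V : P.types → EucSp 2, V = fun θ : P.types =>
      M.field (angleFrom e (θ : EucSp 2)) (x θ) q := ⟨_, rfl⟩
  have hVθ : ∀ θ : P.types, V θ = M.field (angleFrom e (θ : EucSp 2)) (x θ) q :=
    fun θ => congrFun hV θ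
  have hsub : closure (Set.range x) ⊆ P.alloc := by
    refine P.isCompact_alloc.isClosed.closure_subset_iff.mpr ?_
    rintro _ ⟨θ, rfl⟩
    exact hx.feasible θ
  -- both signs of the displacement preserve incentive compatibility and feasibility
  have hgood : ∀ s : ℝ, |s| = ε → (∀ θ, x θ + s • V θ ∈ P.alloc) ∧
      ∀ θ θ' : P.types, ⟪x θ' + s • V θ', (θ : EucSp 2)⟫ ≤ ⟪x θ + s • V θ, (θ : EucSp 2)⟫ := by
    intro s hs
    have hs' : |s| * K ≤ 1 := hs ▸ hεK
    constructor
    · intro θ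
      refine P.mem_alloc_of_facets fun H hH => ?_
      obtain ⟨n, c, b, hn, hHn, hle, hb, hz⟩ := hfacet H hH
      refine ⟨n, c, hHn, hle, ?_⟩
      have h := M.inner_add_smul_field_le hq hs' hb (hx.isSupport he θ)
        (angleFrom_mem_Ioc e n) (angleFrom_mem_Ioc e θ)
      rw [← hVθ] at h
      obtain ⟨ρ, hρ, hnρ⟩ := exists_eq_smul_dirVec he hn
      have h' : ⟪x θ + s • V θ, n⟫ ≤ ⟪b + s • M.field (angleFrom e n) b q, n⟫ := by
        have h2 := mul_le_mul_of_nonneg_left h hρ.le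
        rwa [← inner_smul_right, ← inner_smul_right, ← hnρ] at h2
      have h'' : ⟪b + s • M.field (angleFrom e n) b q, n⟫ = ⟪n, b⟫ := by
        rw [real_inner_comm, inner_add_right, inner_smul_right, hz, mul_zero, add_zero]
      rw [real_inner_comm, h''] at h'
      exact h'.trans (hle b (hsub hb.1))
    · intro θ θ'
      have h := M.inner_add_smul_field_le hq hs' (hx.isSupport he θ) (hx.isSupport he θ')
        (angleFrom_mem_Ioc e θ) (angleFrom_mem_Ioc e θ')
      rw [← hVθ, ← hVθ] at h
      obtain ⟨ρ, hρ, hθ⟩ := exists_eq_smul_dirVec he fun h => P.zero_notMem_types (h ▸ θ.2)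
      have h2 := mul_le_mul_of_nonneg_left h hρ.le
      rwa [← inner_smul_right, ← inner_smul_right, ← hθ] at h2
  have hVmeas : Measurable V := by
    rw [hV]
    exact M.measurable_field q ((measurable_angleFrom e).comp measurable_subtype_coe) hx.measurable
  obtain ⟨hf1, hi1⟩ := hgood ε (abs_of_pos hε0)
  obtain ⟨hf2, hi2⟩ := hgood (-ε) (by rw [abs_neg, abs_of_pos hε0])
  simp only [neg_smul, ← sub_eq_add_neg] at hf2 hi2
  have hnull := inner_eq_zero_of_mem_extremePoints (w := fun θ => ε • V θ) hx hext
    (hVmeas.const_smul ε) hf1 hf2 hi1 hi2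
  -- the displaced mechanism has the same utility, so it gives a sharp type the same allocation
  have hfix := hsharp (x θ + ε • V θ) (fun θ' => by
      have h := hi1 θ' θ
      rwa [inner_add_left (x θ'), hnull θ', add_zero] at h)
    (by rw [inner_add_left, hnull θ, add_zero]; rfl)
  rw [add_eq_left, smul_eq_zero] at hfix
  rw [← hVθ]
  exact hfix.resolve_left hε0.ne'

/-- An extreme mechanism has at most as many sharp points as there are facets. -/
theorem IsICIRMechanism.finite_sharpPoints (hx : P.IsICIRMechanism x)
    (hext : P.toClass x ∈ P.mechanisms.extremePoints ℝ) :
    (P.sharpPoints (P.payoff x)).Finite ∧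
      (P.sharpPoints (P.payoff x)).ncard ≤ P.facetHyperplanes.ncard := by
  rw [← Set.encard_le_coe_iff_finite_ncard_le]
  by_contra! hlt
  have := P.facetHyperplanes_finite.fintype
  have : Nonempty P.facetHyperplanes := P.facetHyperplanes_nonempty.to_subtype
  obtain ⟨g, hginj, hg⟩ : ∃ g : Option P.facetHyperplanes → EucSp 2, Function.Injective g ∧
      ∀ o, g o ∈ P.sharpPoints (P.payoff x) := by
    obtain ⟨t, htD, htcard⟩ := Set.exists_subset_encard_eq (Order.add_one_le_of_lt hlt)
    have htcard' : t.encard = ((P.facetHyperplanes.ncard + 1 : ℕ) : ℕ∞) := by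
      rw [htcard]; norm_cast
    have htfin : t.Finite := Set.finite_of_encard_eq_coe htcard'
    have : Finite t := htfin
    have htncard : t.ncard = P.facetHyperplanes.ncard + 1 := by
      rw [← Nat.cast_inj (R := ℕ∞), htfin.cast_ncard_eq, htcard']
    have hcard : Nat.card (Option P.facetHyperplanes) = Nat.card t := by
      rw [Finite.card_option, Nat.card_coe_set_eq, Nat.card_coe_set_eq, htncard]
    obtain ⟨φ⟩ := Finite.card_eq.mp hcard
    exact ⟨fun o => (φ o : EucSp 2), fun a b h => φ.injective (Subtype.ext h),
      fun o => htD (φ o).2⟩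
  choose T hT using hg
  have hxT : ∀ o, x (T o) = g o := fun o => (hT o).2.2 _ (fun θ' => hx.ic θ' (T o)) rfl
  have hsharp : ∀ o, ∀ b : EucSp 2, (∀ θ' : P.types, ⟪b, (θ' : EucSp 2)⟫ ≤ P.payoff x θ') →
      ⟪b, (T o : EucSp 2)⟫ = P.payoff x (T o) → b = x (T o) := fun o b h1 h2 =>
    ((hT o).2.2 b h1 h2).trans (hxT o).symm
  have h0 : (T none : EucSp 2) ≠ 0 := fun h => P.zero_notMem_types (h ▸ (T none).2)
  set e : EucSp 2 := -(T none : EucSp 2) with he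
  have he0 : e ≠ 0 := neg_ne_zero.mpr h0
  have hπ : angleFrom e (T none) = Real.pi := angleFrom_neg_self h0
  have huniq : ∀ o c, IsSupport (closure (Set.range x)) e (angleFrom e (T o)) c → c = x (T o) :=
    fun o c hc => hx.eq_of_isSupport he0 (hsharp o) hc
  have hne : ∀ i : P.facetHyperplanes, x (T (some i)) ≠ x (T none) := fun i h => by
    rw [hxT, hxT] at h
    exact Option.some_ne_none i (hginj h)
  set M : Markers (closure (Set.range x)) e P.facetHyperplanes :=
    { top := x (T none)
      pt := fun i => x (T (some i))
      ang := fun i => angleFrom e (T (some i))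
      top_support := hπ ▸ hx.isSupport he0 (T none)
      top_unique := fun c hc => huniq none c (hπ.symm ▸ hc)
      support := fun i => hx.isSupport he0 _
      unique := fun i c hc => huniq (some i) c hc
      ang_mem := fun i => ⟨(angleFrom_mem_Ioc e _).1, lt_of_le_of_ne (angleFrom_mem_Ioc e _).2
        fun h => hne i (huniq none _ (by rw [hπ, ← h]; exact hx.isSupport he0 _))⟩
      pt_injective := fun i j h => by
        dsimp only at h
        rw [hxT, hxT] at h
        exact Option.some_injective _ (hginj h)
      pt_ne_top := hne } with hM
  have hcomp : IsCompact (closure (Set.range x)) := by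
    refine P.isCompact_alloc.of_isClosed_subset isClosed_closure ?_
    refine P.isCompact_alloc.isClosed.closure_subset_iff.mpr ?_
    rintro _ ⟨θ, rfl⟩
    exact hx.feasible θ
  have hdata : ∀ i : P.facetHyperplanes, ∃ (n : EucSp 2) (c : ℝ) (b : EucSp 2), n ≠ 0 ∧
      (i : Set (EucSp 2)) = {z | ⟪n, z⟫ = c} ∧ (∀ a ∈ P.alloc, ⟪n, a⟫ ≤ c) ∧
      IsSupport (closure (Set.range x)) e (angleFrom e n) b := by
    rintro ⟨H, n, c, hn, hH, hle, -⟩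
    obtain ⟨b, hb, hmax⟩ := hcomp.exists_isMaxOn
      ⟨x (T none), subset_closure ⟨_, rfl⟩⟩
      (f := fun b => ⟪b, dirVec e (angleFrom e n)⟫) (by fun_prop)
    refine ⟨n, c, b, ?_, hH, hle, hb, fun b' hb' => hmax hb'⟩
    rintro rfl
    simp at hn
  choose n c b hn hHn hle hb using hdata
  obtain ⟨q, hq0, hq, hqf⟩ := M.exists_ne_zero
    (fun i => (innerₛₗ ℝ (n i)).comp (M.field (angleFrom e (n i)) (b i)))
  have hfix : ∀ o, M.field (angleFrom e (T o)) (x (T o)) q = 0 := fun o =>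
    field_eq_zero_of_sharp hx hext he0 M hq
      (fun H hH => ⟨n ⟨H, hH⟩, c ⟨H, hH⟩, b ⟨H, hH⟩, hn _, hHn ⟨H, hH⟩, hle _, hb _, hqf ⟨H, hH⟩⟩)
      (hsharp o)
  exact hq0 (M.eq_zero_of_field_eq_zero hq (hπ ▸ hfix none) fun i => hfix (some i))

/-! ### Exhaustiveness -/

/-- A homothety of utility functions acts on their sharp points. -/
theorem smul_add_mem_sharpPoints {U U' : P.types → ℝ} {r : ℝ} {t : EucSp 2} (hr : 0 < r)
    (hU : ∀ θ, U θ = r * U' θ + ⟪t, (θ : EucSp 2)⟫) {a : EucSp 2} (ha : a ∈ P.sharpPoints U') :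
    r • a + t ∈ P.sharpPoints U := by
  obtain ⟨θ, h1, h2, h3⟩ := ha
  refine ⟨θ, ?_, fun θ' => ?_, fun b hb hbθ => ?_⟩
  · rw [inner_add_left, real_inner_smul_left, h1, hU]
  · rw [inner_add_left, real_inner_smul_left, hU]
    have := mul_le_mul_of_nonneg_left (h2 θ') hr.le
    linarith
  · have hb' := h3 (r⁻¹ • (b - t)) (fun θ' => by
        rw [real_inner_smul_left, inner_sub_left, inv_mul_le_iff₀ hr]
        have := hb θ'
        rw [hU] at this
        linarith)
      (by
        rw [real_inner_smul_left, inner_sub_left, hbθ, hU]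
        field_simp
        ring)
    rw [← hb', smul_inv_smul₀ hr.ne']
    abel

theorem sharpPoints_homothetic {U U' : P.types → ℝ} {r : ℝ} {t : EucSp 2} (hr : 0 < r)
    (hU : ∀ θ, U θ = r * U' θ + ⟪t, (θ : EucSp 2)⟫) :
    P.sharpPoints U' = (fun a => r⁻¹ • (a - t)) '' P.sharpPoints U := by
  apply subset_antisymm
  · intro a ha
    exact ⟨r • a + t, smul_add_mem_sharpPoints hr hU ha, by simp [hr.ne']⟩
  · rintro _ ⟨a, ha, rfl⟩
    have hU' : ∀ θ, U' θ = r⁻¹ * U θ + ⟪-(r⁻¹ • t), (θ : EucSp 2)⟫ := fun θ => by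
      rw [hU, inner_neg_left, real_inner_smul_left]
      field_simp
      ring
    have := smul_add_mem_sharpPoints (inv_pos.mpr hr) hU' ha
    rwa [← sub_eq_add_neg, ← smul_sub] at this

/-- If a homothetic mechanism `ξ'` binds all facets that an extreme mechanism `ξ` binds, then moving
from `ξ` towards or away from `ξ'` is feasible: a facet bound by both supports both menus, so the
homothety maps its hyperplane to itself. -/
theorem exhaustive_of_mem_extremePoints (hx : P.IsICIRMechanism x)
    (hext : P.toClass x ∈ P.mechanisms.extremePoints ℝ) : P.Exhaustive (P.toClass x) := by
  rintro ⟨_, ⟨x', hx', rfl⟩, hne, ⟨r, t, hr, hhom⟩, hsub⟩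
  have hfin := (hx.finite_sharpPoints hext).1
  have hU : ∀ θ, P.payoff x θ = r * P.payoff x' θ + ⟪t, (θ : EucSp 2)⟫ := by
    have h : P.toClass x = P.toClass (r • x' + fun _ => t) := by
      rw [hhom, toClass, toClass, toClass, ← map_smul, ← map_add]
    intro θ
    have := (P.toClass_eq_iff _ _).mp h θ
    rwa [Pi.add_apply, Pi.smul_apply, inner_add_left, real_inner_smul_left] at this
  have hD' := sharpPoints_homothetic hr hU
  have hfin' : (P.sharpPoints (P.payoff x')).Finite := by rw [hD']; exact hfin.image _
  obtain ⟨y, hy, hyU, hyD⟩ := hx.exists_sharp_valued hfin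
  have hclass : P.toClass y = P.toClass x := (P.toClass_eq_iff_payoff _ _).mpr hyU
  set D := P.sharpPoints (P.payoff x) with hD
  have hDA : ∀ a ∈ D, a ∈ P.alloc := by
    intro a ha
    obtain ⟨θ, rfl⟩ := hx.mem_range_of_sharp ha
    exact hx.feasible θ
  have hDA' : ∀ a ∈ D, r⁻¹ • (a - t) ∈ P.alloc := by
    intro a ha
    have : r⁻¹ • (a - t) ∈ P.sharpPoints (P.payoff x') := by
      rw [hD']
      exact ⟨a, ha, rfl⟩
    obtain ⟨θ, h⟩ := hx'.mem_range_of_sharp this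
    exact h ▸ hx'.feasible θ
  set k : ℝ := 1 - r⁻¹ with hk
  -- the difference of the two mechanisms at an allocation of the first
  set W : EucSp 2 → EucSp 2 := fun a => k • a + r⁻¹ • t with hW
  have hfacet : ∀ H ∈ P.facetHyperplanes, ∃ (n : EucSp 2) (c : ℝ), H = {z | ⟪n, z⟫ = c} ∧
      (∀ a ∈ P.alloc, ⟪n, a⟫ ≤ c) ∧
      ((∀ a ∈ D, ⟪n, a⟫ < c) ∨ ∀ a, ⟪n, W a⟫ = k * (⟪n, a⟫ - c)) := by
    rintro H hH
    obtain ⟨n, c, hn, rfl, hle, -⟩ := id hH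
    refine ⟨n, c, rfl, hle, ?_⟩
    by_cases hmeet : (P.menu (P.toClass x) ∩ {z | ⟪n, z⟫ = c}).Nonempty
    · right
      obtain ⟨-, b', hb', hb'c⟩ := hsub ⟨hH, hmeet⟩
      obtain ⟨a₀, ha₀, ha₀c⟩ := hmeet
      rw [hx.menu_eq hfin] at ha₀
      rw [hx'.menu_eq hfin', hD'] at hb'
      obtain ⟨b₀, hb₀, rfl⟩ := hb'
      have h1 := hle _ (hDA' a₀ ha₀)
      have h2 := hle _ (hDA b₀ hb₀)
      simp only [Set.mem_ofPred_eq] at ha₀c hb'c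
      rw [inner_smul_right, inner_sub_right, ha₀c, inv_mul_le_iff₀ hr] at h1
      rw [inner_smul_right, inner_sub_right, inv_mul_eq_iff_eq_mul₀ hr.ne'] at hb'c
      have h3 : ⟪n, t⟫ = c - r * c := by linarith
      intro a
      simp only [hW, hk, inner_add_right, inner_smul_right, h3]
      field_simp
      ring
    · left
      intro a ha
      refine lt_of_le_of_ne (hle a (hDA a ha)) fun h => hmeet ⟨a, ?_, h⟩
      rwa [hx.menu_eq hfin]
  have hev : ∀ᶠ s : ℝ in nhds 0, 0 ≤ 1 + s * k ∧ ∀ a ∈ D, a + s • W a ∈ P.alloc := by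
    have hpos : ∀ᶠ s : ℝ in nhds 0, 0 < 1 + s * k := by
      have hc : Continuous fun s : ℝ => 1 + s * k := by fun_prop
      exact continuousAt_const.eventually_lt hc.continuousAt (by simp)
    have hall : ∀ᶠ s : ℝ in nhds 0, ∀ H ∈ P.facetHyperplanes, ∀ a ∈ D,
        ∃ (n : EucSp 2) (c : ℝ), H = {z | ⟪n, z⟫ = c} ∧ (∀ a ∈ P.alloc, ⟪n, a⟫ ≤ c) ∧
          ⟪n, a + s • W a⟫ ≤ c := by
      rw [Filter.eventually_all_finite P.facetHyperplanes_finite]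
      intro H hH
      rw [Filter.eventually_all_finite hfin]
      intro a ha
      obtain ⟨n, c, hHn, hle, h | h⟩ := hfacet H hH
      · have h' : ⟪a, n⟫ < c := by rw [real_inner_comm]; exact h a ha
        filter_upwards [eventually_inner_add_smul_lt (v := W a) h'] with s hs
        exact ⟨n, c, hHn, hle, by rw [real_inner_comm]; exact hs.le⟩
      · filter_upwards [hpos] with s hs
        refine ⟨n, c, hHn, hle, ?_⟩
        rw [inner_add_right, inner_smul_right, h a]
        have := hle a (hDA a ha)
        nlinarith
    filter_upwards [hpos, hall] with s hs h
    exact ⟨hs.le, fun a ha => P.mem_alloc_of_facets fun H hH => h H hH a ha⟩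
  have hev' : ∀ᶠ s : ℝ in nhds 0, 0 ≤ 1 + (-s) * k ∧ ∀ a ∈ D, a + (-s) • W a ∈ P.alloc := by
    have : Filter.Tendsto (fun s : ℝ => -s) (nhds 0) (nhds 0) := by
      simpa using (continuous_neg (G := ℝ)).tendsto 0
    exact this.eventually hev
  obtain ⟨s, ⟨⟨h1, h2⟩, h3, h4⟩, hs⟩ := (((hev.and hev').filter_mono nhdsWithin_le_nhds).and
    (self_mem_nhdsWithin (s := Set.Ioi (0 : ℝ)))).exists
  have hs0 : (0 : ℝ) < s := hs
  have hic : ∀ s : ℝ, 0 ≤ 1 + s * k → ∀ θ θ' : P.types,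
      ⟪y θ' + s • W (y θ'), (θ : EucSp 2)⟫ ≤ ⟪y θ + s • W (y θ), (θ : EucSp 2)⟫ := by
    intro s hs θ θ'
    have h := mul_le_mul_of_nonneg_left (hy.ic θ θ') hs
    simp only [hW, inner_add_left, real_inner_smul_left]
    linarith
  have hWmeas : Measurable fun θ => W (y θ) :=
    (hy.measurable.const_smul k).add_const _
  have hic2 := hic (-s) h3
  simp only [neg_smul, ← sub_eq_add_neg] at h4 hic2
  have hnull := inner_eq_zero_of_mem_extremePoints (w := fun θ => s • W (y θ)) hy
    (hclass ▸ hext) (hWmeas.const_smul s) (fun θ => h2 _ (hyD θ)) (fun θ => h4 _ (hyD θ))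
    (hic s h1) hic2
  refine hne ((P.toClass_eq_iff_payoff _ _).mpr (funext fun θ => ?_))
  have h5 := hnull θ
  rw [real_inner_smul_left, mul_eq_zero] at h5
  have h6 := h5.resolve_left hs0.ne'
  have h7 : ⟪y θ, (θ : EucSp 2)⟫ = P.payoff x θ := congrFun hyU θ
  simp only [hW, hk, inner_add_left, real_inner_smul_left, h7] at h6
  have h8 := hU θ
  field_simp at h6
  have h9 : r * P.payoff x' θ = r * P.payoff x θ := by linarith
  exact mul_left_cancel₀ hr.ne' h9

end ScreeningProblem

theorem mainTheorem2 (P : ScreeningProblem 2) (ξ : P.PayoffClass)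
    (hξ : ξ ∈ P.mechanisms.extremePoints ℝ) :
    P.Exhaustive ξ ∧ (P.menu ξ).Finite ∧
      (P.menu ξ).ncard ≤ P.facetHyperplanes.ncard := by
  obtain ⟨x, hx, rfl⟩ := hξ.1
  have hfin := hx.finite_sharpPoints hξ
  rw [hx.menu_eq hfin.1]
  exact ⟨ScreeningProblem.exhaustive_of_mem_extremePoints hx hξ, hfin⟩
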